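/- **Setting.** Let $(\Omega,\mathcal A,(p_\theta\mu)_{\theta\in\Theta})$ be a statistical model with $\Theta$ totally ordered, $P_\theta=p_\theta\mu$ probability measures with measurable densities $p_\theta:\Omega\to[0,\infty)$, and let $T:\Omega\to\mathbb R$ be measurable. Assume monotone likelihood ratio in $T$: for all $\theta'\prec\theta''$ there is a nondecreasing $h:\mathbb R\to[0,+\infty]$ with $p_{\theta''}/p_{\theta'}=h(T)$ outside $\{p_{\theta'}=p_{\theta''}=0\}$. *Unilateral hypotheses* are an ordered partition $\{\Theta_1,\Theta_0\}$ of $\Theta$: $\Theta=\Theta_1\cup\Theta_0$, both nonempty, $\theta_1\prec\theta_0$ for all $\theta_1\in\Theta_1,\theta_0\in\Theta_0$. $D_i=D_i^{\Theta_0}$ (resp. $D_s=D_s^{\Theta_1}$) is the largest lower (resp. upper) half-line $D\subseteq\mathbb R$, open or closed, possibly empty, such that all $p_\theta$, $\theta\in\Theta_0$ (resp. $\theta\in\Theta_1$), vanish on $T^{-1}(D)$. Put $N=\{t\in\mathbb R:\ p_\theta(\omega)=0\ \ \forall\theta\in\Theta,\ \forall\omega\in T^{-1}(t)\}$. For a statistic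 $S$ with values in $[-\infty,+\infty]$, its mid-distribution function under $P_\theta$ is $k\mapsto\frac12[P_\theta(S<k)+P_\theta(S\le k)]$. *Normalized families.* A normalized family for $\{\Theta_1,\Theta_0\}$ consists of nondecreasing $h_{(\theta_0,\theta_1)}:\mathbb R\to[0,+\infty]$, $(\theta_0,\theta_1)\in\Theta_0\times\Theta_1$, with $p_{\theta_0}/p_{\theta_1}=h_{(\theta_0,\theta_1)}(T)$ outside $\{p_{\theta_0}=p_{\theta_1}=0\}$, constant on every interval $I\subseteq\mathbb R\setminus(D_i\cup D_s)$ such that $p_{\theta_0}=p_{\theta_1}=0$ on $T^{-1}(I)$, equal to $+\infty$ on $D_s$ and to $0$ on $D_i\setminus D_s$. *Experts.* For $t\in[-\infty,+\infty]$, $u\in\{0,1\}$ let $f_{(t,u)}=1_{\{T<t\}}+u\,1_{\{T=t\}}$; the pairs are ordered lexicographically, and $F$ is the set of all pairs other than $(-\infty,0)$ and $(+\infty,1)$, with the order topology. $\Delta_s\subseteq F$ is the set of the tests $1_{\{h<k\}}(T)+\beta 1_{\{h=k\}}(T)$, where $h=h_{(\theta_0,\theta_1)}$ runs over the family and $(k,\beta)$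 over $(0,1)$, $(k,\beta)$ with $0<k<\infty$, $\beta\in\{0,1\}$, and $(\infty,0)$ (a test being identified with the half-line of $\mathbb R$ which it indicates); $\overline{\Delta_s}$ is its closure in $F$, the set of experts. *Essential statistic.* For $t\in\mathbb R$ let $(a_t,u_t)$ be the supremum of $\{f\in\overline{\Delta_s}:f\le f_{(t,0)}\}\cup\{f_{(-\infty,0)}\}$ and $(b_t,v_t)$ the infimum of $\{f\in\overline{\Delta_s}:f\ge f_{(t,1)}\}\cup\{f_{(+\infty,1)}\}$. The essential statistic of the problem $\{\Theta_1,\Theta_0\}$ (for the chosen family) is $K^{\Theta_1}(T)$, where $K^{\Theta_1}(t)$ is $-\infty$ if $(a_t,u_t)=(-\infty,0)$; $b_t-1$ if $(a_t,u_t)=(-\infty,1)$; $(a_t+b_t)/2$ if $-\infty<a_t\le b_t<+\infty$; $a_t+1$ if $(b_t,v_t)=(+\infty,0)$ and $a_t>-\infty$; $+\infty$ if $(b_t,v_t)=(+\infty,1)$. Its mid-distribution function under $P_\theta$ is $G_\theta^{\Theta_1}$. *Vote.* Let $m_\theta,m'_\theta$ be the Borel probabilities on $\overline{\Delta_s}$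 given by $m_\theta(\{g<f\})=E_\theta(f)$ for $f\ne\inf\overline{\Delta_s}$ and $m'_\theta(\{g\le f\})=E_\theta(f)$ for $f\neq\sup\overline{\Delta_s}$. The vote for $\Theta_1$ under $P_\theta$ at $\omega$ is $Q_\theta^\omega(\{1\})=\int_{\overline{\Delta_s}}f(\omega)\,d\frac{m_\theta+m'_\theta}{2}(f)$. **Proposition.** There is a nondecreasing function $K:\mathbb R\to[-\infty,+\infty]$ such that the mid-distribution functions $G_\theta$ of $K(T)$ under $P_\theta$ satisfy, for all unilateral hypotheses $\{\Theta_1,\Theta_0\}$ (for which normalized families exist): 1. for every choice of the normalized family for $\{\Theta_1,\Theta_0\}$, all $t\in\mathbb R\setminus(D_i^{\Theta_0}\cup D_s^{\Theta_1}\cup N)$ and all $\theta\in\Theta$: $G_\theta(K(t))=G_\theta^{\Theta_1}(K^{\Theta_1}(t))$; 2. $G_{\theta_0}(K(t))=0$ for all $t\in D_i^{\Theta_0}\setminus N$ and all $\theta_0\in\Theta_0$; 3. $G_{\theta_1}(K(t))=1$ for all $t\in D_s^{\Theta_1}\setminus N$ and all $\theta_1\in\Theta_1$; 4. for every choice of the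 normalized family, every $\omega$ with $T(\omega)\notin D_i^{\Theta_0}\cup D_s^{\Theta_1}\cup N$ and every $\theta\in\Theta$, the vote is well defined and $Q_\theta^\omega(\{1\})=1-G_\theta(K(T(\omega)))$. -/

import Mathlib

open MeasureTheory Set
open scoped ENNReal NNReal

noncomputable section

namespace ExpertVote

/-! ### Threshold tests -/

/-- Pairs `(t, u)` with `t ∈ [-∞, +∞]` and `u ∈ {0, 1}` (`false = 0`, `true = 1`), in the
lexicographic order. The pair `(t, u)` stands for the test function
`f_(t,u) = 1_{T < t} + u 1_{T = t}`. -/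
def Cut : Type := EReal ×ₗ Bool

namespace Cut

instance : LinearOrder Cut := inferInstanceAs (LinearOrder (EReal ×ₗ Bool))

/-- The pair `(t, u)`. -/
def mk (t : EReal) (u : Bool) : Cut := toLex (t, u)

/-- The threshold `t` of the pair `(t, u)`. -/
def pt (c : Cut) : EReal := (ofLex (α := EReal × Bool) c).1

/-- The second component `u` of the pair `(t, u)`. -/
def incl (c : Cut) : Bool := (ofLex (α := EReal × Bool) c).2

/-- The topology of the order. -/
instance : TopologicalSpace Cut := Preorder.topology Cut

instance : OrderTopology Cut := ⟨rfl⟩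

/-- The Borel sigma-algebra of the topology of the order. -/
instance : MeasurableSpace Cut := borel Cut

instance : BorelSpace Cut := ⟨rfl⟩

theorem le_iff (c d : Cut) : c ≤ d ↔ c.pt < d.pt ∨ (c.pt = d.pt ∧ c.incl ≤ d.incl) :=
  Prod.Lex.le_iff (α := EReal) (β := Bool)

open Classical in
/-- Least upper bounds of sets of pairs. -/
instance : SupSet Cut :=
  ⟨fun S => mk (sSup (pt '' S)) (decide (mk (sSup (pt '' S)) true ∈ S))⟩

open Classical in
/-- Greatest lower bounds of sets of pairs. -/
instance : InfSet Cut :=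
  ⟨fun S => mk (sInf (pt '' S)) (!decide (mk (sInf (pt '' S)) false ∈ S))⟩

theorem isLUB_sSup (S : Set Cut) : IsLUB S (sSup S) := by
  classical
  constructor
  · intro c hc
    have h1 : c.pt ≤ sSup (pt '' S) := le_sSup ⟨c, hc, rfl⟩
    rw [le_iff]
    rcases h1.lt_or_eq with h | h
    · exact Or.inl h
    · refine Or.inr ⟨h, ?_⟩
      change c.incl ≤ decide (mk (sSup (pt '' S)) true ∈ S)
      cases hb : c.incl
      · exact Bool.false_le _
      · have hcm : mk (sSup (pt '' S)) true = c := by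
          rw [← h, ← hb]; rfl
        rw [hcm]
        simp [hc]
  · intro d hd
    have h1 : sSup (pt '' S) ≤ d.pt := by
      refine sSup_le ?_
      rintro _ ⟨c, hc, rfl⟩
      rcases (le_iff c d).1 (hd hc) with h | h
      · exact h.le
      · exact h.1.le
    by_cases hm : mk (sSup (pt '' S)) true ∈ S
    · have h2 : sSup S = mk (sSup (pt '' S)) true := by
        change mk (sSup (pt '' S)) (decide (mk (sSup (pt '' S)) true ∈ S)) = _
        simp [hm]
      rw [h2]
      exact hd hm
    · have h2 : sSup S = mk (sSup (pt '' S)) false := by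
        change mk (sSup (pt '' S)) (decide (mk (sSup (pt '' S)) true ∈ S)) = _
        simp [hm]
      rw [h2, le_iff]
      rcases h1.lt_or_eq with h | h
      · exact Or.inl h
      · exact Or.inr ⟨h, Bool.false_le _⟩

theorem isGLB_sInf (S : Set Cut) : IsGLB S (sInf S) := by
  classical
  constructor
  · intro c hc
    have h1 : sInf (pt '' S) ≤ c.pt := sInf_le ⟨c, hc, rfl⟩
    rw [le_iff]
    rcases h1.lt_or_eq with h | h
    · exact Or.inl h
    · refine Or.inr ⟨h, ?_⟩
      change (!decide (mk (sInf (pt '' S)) false ∈ S)) ≤ c.incl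
      cases hb : c.incl
      · have hcm : mk (sInf (pt '' S)) false = c := by
          rw [h, ← hb]; rfl
        rw [hcm]
        simp [hc]
      · exact Bool.le_true _
  · intro d hd
    have h1 : d.pt ≤ sInf (pt '' S) := by
      refine le_sInf ?_
      rintro _ ⟨c, hc, rfl⟩
      rcases (le_iff d c).1 (hd hc) with h | h
      · exact h.le
      · exact h.1.le
    by_cases hm : mk (sInf (pt '' S)) false ∈ S
    · have h2 : sInf S = mk (sInf (pt '' S)) false := by
        change mk (sInf (pt '' S)) (!decide (mk (sInf (pt '' S)) false ∈ S)) = _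
        simp [hm]
      rw [h2]
      exact hd hm
    · have h2 : sInf S = mk (sInf (pt '' S)) true := by
        change mk (sInf (pt '' S)) (!decide (mk (sInf (pt '' S)) false ∈ S)) = _
        simp [hm]
      rw [h2, le_iff]
      rcases h1.lt_or_eq with h | h
      · exact Or.inl h
      · exact Or.inr ⟨h, Bool.le_true _⟩

open Classical in
/-- The value at `T = x` of the test function `f_(t,u) = 1_{T < t} + u 1_{T = t}`. -/
def test (c : Cut) (x : ℝ) : ℝ :=
  (if (x : EReal) < c.pt then 1 else 0) + (if c.incl = true ∧ (x : EReal) = c.pt then 1 else 0)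

/-- The set `F` of threshold tests: `(-∞, 1)`, the `(t, u)` with `t` real, and `(+∞, 0)`. The two
other pairs `(-∞, 0)` and `(+∞, 1)` are isolated points of `Cut`, added below and above `F`, so
that closures (and the Borel structure) of subsets of `F` are the same in `F` and in `Cut`. -/
def threshold : Set Cut := {c | c ≠ mk ⊥ false ∧ c ≠ mk ⊤ true}

end Cut

/-! ### Simple tests and the essential statistic of a choice between two hypotheses -/

open Classical in
/-- The simple test function `φ_(k,β) = 1_{K < k} + β 1_{K = k}`, where `K = h(T)`, at `T = x`. -/
def simpleTest (h : ℝ → ℝ≥0∞) (k : ℝ≥0∞) (β : Bool) (x : ℝ) : ℝ :=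
  (if h x < k then 1 else 0) + (if β = true ∧ h x = k then 1 else 0)

/-- The indices of the simple tests: `(0, 1)`, `(k, β)` with `0 < k < ∞`, and `(∞, 0)`. -/
def IsSimpleIndex (k : ℝ≥0∞) (β : Bool) : Prop :=
  (k = 0 ∧ β = true) ∨ (0 < k ∧ k < ∞) ∨ (k = ∞ ∧ β = false)

/-- The set `Φ_s` of simple tests built on the ratio `h(T)`, as a subset of `F`. -/
def simpleTests (h : ℝ → ℝ≥0∞) : Set Cut :=
  {c | c ∈ Cut.threshold ∧ ∃ k β, IsSimpleIndex k β ∧ ∀ x : ℝ, c.test x = simpleTest h k β x}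

variable {Ω Θ : Type*}

/-- The set `Δ_s`: all simple tests built on the ratios `h_(θ₀,θ₁)(T)`, `θ₀ ∈ Θ₀`, `θ₁ ∈ Θ₁`. -/
def allSimpleTests (Θ₀ Θ₁ : Set Θ) (h : Θ → Θ → ℝ → ℝ≥0∞) : Set Cut :=
  ⋃ θ₀ ∈ Θ₀, ⋃ θ₁ ∈ Θ₁, simpleTests (h θ₀ θ₁)

/-- The expert space: the closure of `Δ_s` for the topology of the order. -/
def experts (Θ₀ Θ₁ : Set Θ) (h : Θ → Θ → ℝ → ℝ≥0∞) : Set Cut :=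
  closure (allSimpleTests Θ₀ Θ₁ h)

/-- `f_(a_t,u_t)`: the supremum of the `f ∈ Δ` with `f ≤ f_(t,0)`, together with `f_(-∞,0)`. -/
def lowerExpert (Δ : Set Cut) (t : ℝ) : Cut :=
  sSup ({f ∈ Δ | f ≤ Cut.mk t false} ∪ {Cut.mk ⊥ false})

/-- `f_(b_t,v_t)`: the infimum of the `f ∈ Δ` with `f ≥ f_(t,1)`, together with `f_(+∞,1)`. -/
def upperExpert (Δ : Set Cut) (t : ℝ) : Cut :=
  sInf ({f ∈ Δ | Cut.mk t true ≤ f} ∪ {Cut.mk ⊤ true})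

open Classical in
/-- The value of `K(t)` as a function of `(a_t, u_t)` and `(b_t, v_t)`. -/
def essentialValue (a b : Cut) : EReal :=
  if a = Cut.mk ⊥ false then ⊥
  else if a = Cut.mk ⊥ true then b.pt - 1
  else if b = Cut.mk ⊤ true then ⊤
  else if b = Cut.mk ⊤ false then a.pt + 1
  else (a.pt + b.pt) / 2

/-- The function `K` defining the essential statistic `K(T)` of the choice between `Θ₀` and `Θ₁`,
for the family of ratios `h`. -/
def essentialFun (Θ₀ Θ₁ : Set Θ) (h : Θ → Θ → ℝ → ℝ≥0∞) (t : ℝ) : EReal :=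
  essentialValue (lowerExpert (experts Θ₀ Θ₁ h) t) (upperExpert (experts Θ₀ Θ₁ h) t)

/-! ### Monotone likelihood ratio models and normalized families -/

/-- `h(T)` is the ratio `q₀ / q₁`, outside the set where `q₀ = q₁ = 0`. -/
def IsRatio (q₀ q₁ : Ω → ℝ≥0) (T : Ω → ℝ) (h : ℝ → ℝ≥0∞) : Prop :=
  ∀ ω, ¬ (q₀ ω = 0 ∧ q₁ ω = 0) → (q₀ ω : ℝ≥0∞) / (q₁ ω : ℝ≥0∞) = h (T ω)

/-- Monotone likelihood ratio in the statistic `T`, for the densities `p θ`. -/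
def HasMonotoneLikelihoodRatio [LinearOrder Θ] (p : Θ → Ω → ℝ≥0) (T : Ω → ℝ) : Prop :=
  ∀ θ' θ'' : Θ, θ' < θ'' → ∃ h : ℝ → ℝ≥0∞, Monotone h ∧ IsRatio (p θ'') (p θ') T h

/-- Unilateral hypotheses: an ordered partition `{Θ₁, Θ₀}` of the parameter set. -/
structure IsUnilateral [LinearOrder Θ] (Θ₁ Θ₀ : Set Θ) : Prop where
  union : Θ₁ ∪ Θ₀ = univ
  nonempty₁ : Θ₁.Nonempty
  nonempty₀ : Θ₀.Nonempty
  lt : ∀ θ₁ ∈ Θ₁, ∀ θ₀ ∈ Θ₀, θ₁ < θ₀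

/-- `D_i`: the largest lower half-line `D` (possibly empty) such that on `{T ∈ D}` all densities
`p θ`, `θ ∈ A`, vanish. -/
def lowerNull (p : Θ → Ω → ℝ≥0) (T : Ω → ℝ) (A : Set Θ) : Set ℝ :=
  {t | ∀ ω, T ω ≤ t → ∀ θ ∈ A, p θ ω = 0}

/-- `D_s`: the largest upper half-line `D` (possibly empty) such that on `{T ∈ D}` all densities
`p θ`, `θ ∈ A`, vanish. -/
def upperNull (p : Θ → Ω → ℝ≥0) (T : Ω → ℝ) (A : Set Θ) : Set ℝ :=
  {t | ∀ ω, t ≤ T ω → ∀ θ ∈ A, p θ ω = 0}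

/-- `N`: the totally null points `t`, for which all densities vanish on `{T = t}`. -/
def totallyNull (p : Θ → Ω → ℝ≥0) (T : Ω → ℝ) : Set ℝ :=
  {t | ∀ ω, T ω = t → ∀ θ, p θ ω = 0}

/-- Normalized families `h_(θ₀,θ₁)`, `(θ₀, θ₁) ∈ Θ₀ × Θ₁`, of nondecreasing functions that
express the ratios `p θ₀ / p θ₁` through `T`. -/
structure IsNormalizedFamily (p : Θ → Ω → ℝ≥0) (T : Ω → ℝ) (Θ₀ Θ₁ : Set Θ)
    (h : Θ → Θ → ℝ → ℝ≥0∞) : Prop where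
  mono : ∀ θ₀ ∈ Θ₀, ∀ θ₁ ∈ Θ₁, Monotone (h θ₀ θ₁)
  ratio : ∀ θ₀ ∈ Θ₀, ∀ θ₁ ∈ Θ₁, IsRatio (p θ₀) (p θ₁) T (h θ₀ θ₁)
  const : ∀ θ₀ ∈ Θ₀, ∀ θ₁ ∈ Θ₁, ∀ I : Set ℝ, I.OrdConnected →
    I ⊆ (lowerNull p T Θ₀ ∪ upperNull p T Θ₁)ᶜ →
    (∀ ω, T ω ∈ I → p θ₀ ω = 0 ∧ p θ₁ ω = 0) →
    ∀ x ∈ I, ∀ y ∈ I, h θ₀ θ₁ x = h θ₀ θ₁ y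
  top : ∀ θ₀ ∈ Θ₀, ∀ θ₁ ∈ Θ₁, ∀ t ∈ upperNull p T Θ₁, h θ₀ θ₁ t = ∞
  zero : ∀ θ₀ ∈ Θ₀, ∀ θ₁ ∈ Θ₁, ∀ t ∈ lowerNull p T Θ₀ \ upperNull p T Θ₁, h θ₀ θ₁ t = 0

/-! ### Mid-distribution functions and votes -/

variable [MeasurableSpace Ω]

/-- The mid-distribution function of the statistic `S` under `P`:
`G(k) = [P(S < k) + P(S ≤ k)] / 2`. -/
def midCDF (P : Measure Ω) (S : Ω → EReal) (k : EReal) : ℝ :=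
  (P.real {ω | S ω < k} + P.real {ω | S ω ≤ k}) / 2

/-- The expectation `E(f)` under `P` of a threshold test `f` based on `T`. -/
def testMean (P : Measure Ω) (T : Ω → ℝ) (f : Cut) : ℝ := ∫ ω, f.test (T ω) ∂P

/-- The probability `m` on the set `Δ` of experts (with the trace of the Borel sigma-algebra)
given by `m(]←, f[) = E(f)` for `f ≠ inf Δ`. -/
structure IsLeftWeight (P : Measure Ω) (T : Ω → ℝ) (Δ : Set Cut) (m : Measure Δ) : Prop where
  prob : IsProbabilityMeasure m
  ray : ∀ f : Δ, (f : Cut) ≠ sInf Δ → m.real (Iio f) = testMean P T f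

/-- The probability `m'` on the set `Δ` of experts (with the trace of the Borel sigma-algebra)
given by `m'(]←, f]) = E(f)` for `f ≠ sup Δ`. -/
structure IsRightWeight (P : Measure Ω) (T : Ω → ℝ) (Δ : Set Cut) (m : Measure Δ) : Prop where
  prob : IsProbabilityMeasure m
  ray : ∀ f : Δ, (f : Cut) ≠ sSup Δ → m.real (Iic f) = testMean P T f

/-- The frequency `∫_Δ f(ω) d(m + m')/2` of the experts that decide `1` when `T(ω) = x`. -/
def voteFrequency {Δ : Set Cut} (m m' : Measure Δ) (x : ℝ) : ℝ :=
  ∫ f : Δ, (f : Cut).test x ∂((2⁻¹ : ℝ≥0∞) • (m + m'))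

/-- `q` is the result `Q({1})`, under `P` and for a realization with `T(ω) = x`, of the vote of the
experts `Δ`, weighted by `(m + m')/2`. -/
structure IsVote (P : Measure Ω) (T : Ω → ℝ) (Δ : Set Cut) (x : ℝ) (q : ℝ) : Prop where
  left : ∃ m : Measure Δ, IsLeftWeight P T Δ m
  right : ∃ m' : Measure Δ, IsRightWeight P T Δ m'
  eq : ∀ m m' : Measure Δ, IsLeftWeight P T Δ m → IsRightWeight P T Δ m' →
    voteFrequency m m' x = q

/-- The law `P_θ = p_θ . μ`. -/
def law (μ : Measure Ω) (p : Θ → Ω → ℝ≥0) (θ : Θ) : Measure Ω :=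
  μ.withDensity fun ω => (p θ ω : ℝ≥0∞)

end ExpertVote

end

open ExpertVote

namespace ExpertVote

/-! ### Cuts -/

namespace Cut

/-! Call `s` and `t` indistinguishable if `s = t` or if above the interval between them all
densities factor as `p θ ω = c θ * q ω`. This relation ignores how the parameters are split into
hypotheses. It is convex, and it is transitive through points outside `N`, so a single nondecreasing
`K` separates exactly its classes off `N` (`exists_monotone_lt_iff_not`).

Fix hypotheses and a normalized family. The essential statistic increases strictly from `s` to `t`
iff an expert accepts `s` and rejects `t` (`essentialValue_lt_iff`), iff some ratio satisfies `h s <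
h t` (`exists_mem_experts_iff`). For `s < t` outside `N`, at least one of them outside `D_i ∪ D_s`,
this says that `s` and `t` are not indistinguishable (`essentialFun_lt_iff_not_indistinguishable`).
Hence `K` and the essential statistic compare with their values at a good `t` in the same way almost
surely, and a mid-distribution function depends on nothing else.

For the vote, the weights are the laws of the nearest experts below and above `T`. At a good point
both neighbours are experts, and their means are `P(K(T) < K(x))` and `P(K(T) ≤ K(x))`. -/

@[simp] theorem pt_mk (t : EReal) (u : Bool) : (mk t u).pt = t := rfl

@[simp] theorem incl_mk (t : EReal) (u : Bool) : (mk t u).incl = u := rfl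

theorem mk_pt_incl (c : Cut) : mk c.pt c.incl = c := rfl

theorem pt_mono : Monotone pt := fun c d h => by
  rcases (le_iff c d).1 h with h | h
  exacts [h.le, h.1.le]

theorem lt_of_pt_lt {c d : Cut} (h : c.pt < d.pt) : c < d :=
  lt_of_not_ge fun h' => (pt_mono h').not_gt h

theorem mk_mono {s t : EReal} (h : s ≤ t) (u : Bool) : mk s u ≤ mk t u :=
  (le_iff _ _).2 (h.lt_or_eq.imp id fun h => ⟨h, le_rfl⟩)

theorem mk_false_lt_mk_true (t : EReal) : mk t false < mk t true := by
  rw [← not_le, le_iff]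
  simp

theorem bot_le (c : Cut) : mk ⊥ false ≤ c := by
  rw [le_iff]
  simpa using (_root_.bot_le (a := c.pt)).lt_or_eq

theorem le_top (c : Cut) : c ≤ mk ⊤ true := by
  rw [le_iff]
  simpa [Bool.le_true] using (_root_.le_top (a := c.pt)).lt_or_eq

/-- The pairs `(t, 0)` and `(t, 1)` are adjacent. Every test thus either accepts `t`, being at least
`(t, 1)`, or rejects it, being at most `(t, 0)`. -/
theorem lt_mk_true_iff {c : Cut} {t : EReal} : c < mk t true ↔ c ≤ mk t false := by
  rw [← not_le, le_iff, le_iff]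
  simp only [pt_mk, incl_mk]
  rcases lt_trichotomy c.pt t with h | h | h
  · simp [h, h.not_gt, h.ne']
  · cases hc : c.incl <;> simp [h]
  · simp [h, h.not_gt, h.ne']

theorem not_mk_true_le_iff {c : Cut} {t : EReal} : ¬ mk t true ≤ c ↔ c ≤ mk t false := by
  rw [not_le, lt_mk_true_iff]

theorem mk_true_le_mk_false_iff {s t : EReal} : mk s true ≤ mk t false ↔ s < t := by
  rw [le_iff]
  simp

open Classical in
theorem test_eq (c : Cut) (x : ℝ) : c.test x = if mk x true ≤ c then 1 else 0 := by
  have h : mk x true ≤ c ↔ (x : EReal) < c.pt ∨ (c.incl = true ∧ (x : EReal) = c.pt) := by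
    rw [le_iff]
    simp only [pt_mk, incl_mk]
    cases c.incl <;> simp
  unfold test
  rw [if_congr h rfl rfl]
  by_cases h1 : (x : EReal) < c.pt
  · simp [h1, h1.ne]
  · simp [h1]

/-- Every lower set of real numbers is the set of the points where a threshold test is `1`. -/
theorem exists_threshold_of_isLowerSet {L : Set ℝ} (hL : IsLowerSet L) :
    ∃ c ∈ threshold, ∀ x : ℝ, mk x true ≤ c ↔ x ∈ L := by
  rcases L.eq_empty_or_nonempty with rfl | hne
  -- The empty set and the whole line are represented by `(-∞, 1)` and `(+∞, 0)`, since the two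
  -- extreme pairs are not in `threshold`.
  · refine ⟨mk ⊥ true, ⟨?_, ?_⟩, fun x => ?_⟩
    · intro h
      simpa using congrArg incl h
    · intro h
      simpa using congrArg pt h
    · simp [le_iff]
  by_cases hb : BddAbove L
  · have hlub := isLUB_csSup hne hb
    by_cases hm : sSup L ∈ L
    · refine ⟨mk (sSup L : ℝ) true, ⟨?_, ?_⟩, fun x => ?_⟩
      · intro h
        simpa using congrArg incl h
      · intro h
        simpa using congrArg pt h
      · rw [le_iff]
        simp only [pt_mk, incl_mk, EReal.coe_lt_coe_iff, EReal.coe_eq_coe_iff, le_refl, and_true]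
        rw [← le_iff_lt_or_eq]
        exact ⟨fun h => hL h hm, fun h => hlub.1 h⟩
    · refine ⟨mk (sSup L : ℝ) false, ⟨?_, ?_⟩, fun x => ?_⟩
      · intro h
        simpa using congrArg pt h
      · intro h
        simpa using congrArg incl h
      · rw [mk_true_le_mk_false_iff, EReal.coe_lt_coe_iff]
        constructor
        · intro h
          obtain ⟨y, hy, hxy⟩ := exists_lt_of_lt_csSup hne h
          exact hL hxy.le hy
        · intro h
          exact lt_of_le_of_ne (hlub.1 h) fun h' => hm (h' ▸ h)
  · refine ⟨mk ⊤ false, ⟨?_, ?_⟩, fun x => ?_⟩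
    · intro h
      simpa using congrArg pt h
    · intro h
      simpa using congrArg incl h
    · rw [mk_true_le_mk_false_iff]
      simp only [EReal.coe_lt_top, true_iff]
      obtain ⟨y, hy, hxy⟩ := not_bddAbove_iff.1 hb x
      exact hL hxy.le hy

/-- Up to countably many points, an open set of cuts is the preimage of an open set of
extended real numbers. -/
theorem exists_isOpen_countable_diff {U : Set Cut} (hU : IsOpen U) :
    ∃ W : Set EReal, IsOpen W ∧ pt ⁻¹' W ⊆ U ∧ (U \ pt ⁻¹' W).Countable := by
  set W : Set EReal := interior {s | mk s false ∈ U ∧ mk s true ∈ U} with hW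
  have hWU : pt ⁻¹' W ⊆ U := by
    intro c hc
    have := interior_subset hc
    rw [← mk_pt_incl c]
    cases c.incl
    exacts [this.1, this.2]
  refine ⟨W, isOpen_interior, hWU, ?_⟩
  -- A cut of `U` missed by `W` has, up to the two infinite thresholds, a threshold isolated on one
  -- side in `Wᶜ`. Such points are countably many.
  have hc1 := countable_setOfPred_isolated_right_within (s := Wᶜ)
  have hc2 := countable_setOfPred_isolated_left_within (s := Wᶜ)
  have hc : ({⊥, ⊤} ∪ ({x | x ∈ Wᶜ ∧ nhdsWithin x (Wᶜ ∩ Ioi x) = ⊥} ∪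
      {x | x ∈ Wᶜ ∧ nhdsWithin x (Wᶜ ∩ Iio x) = ⊥}) : Set EReal).Countable :=
    (((countable_singleton _).insert _)).union (hc1.union hc2)
  refine ((hc.prod (Set.countable_univ (α := Bool))).image fun q => mk q.1 q.2).mono ?_
  rintro c ⟨hcU, hcW⟩
  refine ⟨(c.pt, c.incl), ⟨?_, mem_univ _⟩, mk_pt_incl c⟩
  by_contra hcon
  simp only [mem_union, mem_insert_iff, mem_singleton_iff, mem_ofPred_eq, not_or] at hcon
  obtain ⟨⟨hbot, htop⟩, hr, hl⟩ := hcon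
  have hsub : ∀ x y : EReal, (∀ z ∈ Ioo x y, mk z false ∈ U ∧ mk z true ∈ U) →
      ∀ z ∈ Ioo x y, z ∈ W := fun x y h => interior_maximal h isOpen_Ioo
  cases hi : c.incl
  · have hlt : mk ⊥ true < c := lt_of_pt_lt (bot_lt_iff_ne_bot.2 hbot)
    obtain ⟨d, hd, hdU⟩ := exists_Ioc_subset_of_mem_nhds (hU.mem_nhds hcU) ⟨_, hlt⟩
    -- No cut strictly below `(t, 0)` shares its threshold, so the left neighbourhood in `U`
    -- contains both cuts at each `z` in a real interval ending at `t`.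
    have hdc : d.pt < c.pt := by
      rcases (le_iff d c).1 hd.le with h | h
      · exact h
      · refine absurd hd (not_lt.2 ((le_iff _ _).2 (Or.inr ⟨h.1.symm, ?_⟩)))
        rw [hi]
        exact Bool.false_le _
    have hW' := hsub d.pt c.pt fun z hz => ?_
    · refine hl ⟨hcW, Filter.empty_mem_iff_bot.1 ?_⟩
      filter_upwards [inter_mem_nhdsWithin _ (Ioi_mem_nhds hdc)] with z hz
      exact hz.1.1 (hW' z ⟨hz.2, hz.1.2⟩)
    exact ⟨hdU ⟨lt_of_pt_lt hz.1, le_of_lt (lt_of_pt_lt hz.2)⟩,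
      hdU ⟨lt_of_pt_lt hz.1, le_of_lt (lt_of_pt_lt hz.2)⟩⟩
  · have hlt : c < mk ⊤ false := lt_of_pt_lt (lt_top_iff_ne_top.2 htop)
    obtain ⟨d, hd, hdU⟩ := exists_Ico_subset_of_mem_nhds (hU.mem_nhds hcU) ⟨_, hlt⟩
    have hdc : c.pt < d.pt := by
      rcases (le_iff c d).1 hd.le with h | h
      · exact h
      · refine absurd hd (not_lt.2 ((le_iff _ _).2 (Or.inr ⟨h.1.symm, ?_⟩)))
        rw [hi]
        exact Bool.le_true _
    have hW' := hsub c.pt d.pt fun z hz => ?_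
    · refine hr ⟨hcW, Filter.empty_mem_iff_bot.1 ?_⟩
      filter_upwards [inter_mem_nhdsWithin _ (Iio_mem_nhds hdc)] with z hz
      exact hz.1.1 (hW' z ⟨hz.1.2, hz.2⟩)
    exact ⟨hdU ⟨le_of_lt (lt_of_pt_lt hz.1), lt_of_pt_lt hz.2⟩,
      hdU ⟨le_of_lt (lt_of_pt_lt hz.1), lt_of_pt_lt hz.2⟩⟩

/-- The jumps at all `t` leave `Cut` without a countable base. Instead, an open set is the preimage
of an open set of thresholds plus countably many cuts, and the fibres of a monotone map are
intervals. -/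
theorem measurable_of_monotone {g : ℝ → Cut} (hg : Monotone g) : Measurable g := by
  refine measurable_of_isOpen fun U hU => ?_
  obtain ⟨W, hW, hWU, hcount⟩ := exists_isOpen_countable_diff hU
  have h : g ⁻¹' U = (pt ∘ g) ⁻¹' W ∪ ⋃ c ∈ U \ pt ⁻¹' W, g ⁻¹' {c} := by
    ext x
    simp only [mem_preimage, mem_union, mem_iUnion, mem_singleton_iff, Function.comp,
      exists_prop, exists_eq_right']
    constructor
    · intro hx
      by_cases hxW : (g x).pt ∈ W
      exacts [Or.inl hxW, Or.inr ⟨hx, hxW⟩]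
    · rintro (hx | hx)
      exacts [hWU hx, hx.1]
  rw [h]
  refine ((pt_mono.comp hg).measurable hW.measurableSet).union
    (MeasurableSet.biUnion hcount fun c _ => ?_)
  exact (ordConnected_singleton.preimage_mono hg).measurableSet

end Cut

/-! ### The essential statistic -/

section Essential

variable (Δ : Set Cut) (s t : ℝ)

theorem lowerExpert_le : lowerExpert Δ t ≤ Cut.mk t false := by
  refine (Cut.isLUB_sSup _).2 ?_
  rintro f (hf | rfl)
  exacts [hf.2, Cut.bot_le _]

theorem le_upperExpert : Cut.mk t true ≤ upperExpert Δ t := by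
  refine (Cut.isGLB_sInf _).2 ?_
  rintro f (hf | rfl)
  exacts [hf.2, Cut.le_top _]

variable {Δ s t}

theorem le_lowerExpert {f : Cut} (hf : f ∈ Δ) (hft : f ≤ Cut.mk t false) :
    f ≤ lowerExpert Δ t :=
  (Cut.isLUB_sSup _).1 (Or.inl ⟨hf, hft⟩)

theorem upperExpert_le {f : Cut} (hf : f ∈ Δ) (hft : Cut.mk t true ≤ f) :
    upperExpert Δ t ≤ f :=
  (Cut.isGLB_sInf _).1 (Or.inl ⟨hf, hft⟩)

theorem lowerExpert_mono : Monotone (lowerExpert Δ) := fun s t hst => by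
  refine (Cut.isLUB_sSup _).2 ?_
  rintro f (hf | rfl)
  · exact le_lowerExpert hf.1 (hf.2.trans (Cut.mk_mono (EReal.coe_le_coe_iff.2 hst) _))
  · exact Cut.bot_le _

theorem upperExpert_mono : Monotone (upperExpert Δ) := fun s t hst => by
  refine (Cut.isGLB_sInf _).2 ?_
  rintro f (hf | rfl)
  · exact upperExpert_le hf.1 ((Cut.mk_mono (EReal.coe_le_coe_iff.2 hst) _).trans hf.2)
  · exact Cut.le_top _

/-- Once an expert lies below `(t, 0)`, the added point `(-∞, 0)` no longer affects the supremum,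
and a closed set contains the suprema of its nonempty parts. -/
theorem lowerExpert_mem (hΔ : IsClosed Δ) (h : ∃ f ∈ Δ, f ≤ Cut.mk t false) :
    lowerExpert Δ t ∈ Δ := by
  obtain ⟨f, hf, hft⟩ := h
  have hlub : IsLUB (Δ ∩ Iic (Cut.mk t false)) (lowerExpert Δ t) :=
    ⟨fun g hg => le_lowerExpert hg.1 hg.2, fun g hg => (Cut.isLUB_sSup _).2 <| by
      rintro f' (hf' | rfl)
      exacts [hg hf', Cut.bot_le _]⟩
  exact (hlub.mem_of_isClosed ⟨f, hf, hft⟩ (hΔ.inter isClosed_Iic)).1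

theorem upperExpert_mem (hΔ : IsClosed Δ) (h : ∃ f ∈ Δ, Cut.mk t true ≤ f) :
    upperExpert Δ t ∈ Δ := by
  obtain ⟨f, hf, hft⟩ := h
  have hglb : IsGLB (Δ ∩ Ici (Cut.mk t true)) (upperExpert Δ t) :=
    ⟨fun g hg => upperExpert_le hg.1 hg.2, fun g hg => (Cut.isGLB_sInf _).2 <| by
      rintro f' (hf' | rfl)
      exacts [hg hf', Cut.le_top _]⟩
  exact (hglb.mem_of_isClosed ⟨f, hf, hft⟩ (hΔ.inter isClosed_Ici)).1

/-- A midpoint reaches `β` only if `a.pt = β`, which squeezes `s` between them; the other values are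
strictly below `β`. The equality case provides strictness in `essentialValue_lt`. -/
theorem essentialValue_le {a b : Cut} {s β : ℝ} (ha : a ≤ Cut.mk s false) (hb : b.pt = β)
    (hsβ : s ≤ β) : essentialValue a b ≤ β ∧ (essentialValue a b = β → s = β) := by
  have hbt : ∀ u, b ≠ Cut.mk ⊤ u := by
    rintro u rfl
    simp at hb
  unfold essentialValue
  split_ifs with h1 h2 h3 h4
  · simp
  · rw [hb]
    norm_cast
    constructor <;> intros <;> linarith
  · exact absurd h3 (hbt _)
  · exact absurd h4 (hbt _)
  · have has : a.pt ≤ s := Cut.pt_mono ha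
    have hbot : a.pt ≠ ⊥ := fun h => by
      rw [← Cut.mk_pt_incl a, h] at h1 h2
      cases hi : a.incl <;> simp [hi] at h1 h2
    lift a.pt to ℝ using ⟨ne_top_of_le_ne_top (EReal.coe_ne_top s) has, hbot⟩ with α
    rw [hb, show (2 : EReal) = ((2 : ℝ) : EReal) from rfl, ← EReal.coe_add, ← EReal.coe_div]
    simp only [EReal.coe_le_coe_iff, EReal.coe_eq_coe_iff] at has ⊢
    constructor <;> intros <;> linarith

theorem le_essentialValue {a b : Cut} {t α : ℝ} (hb : Cut.mk t true ≤ b) (ha : a.pt = α)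
    (hαt : α ≤ t) : α ≤ essentialValue a b ∧ (essentialValue a b = α → t = α) := by
  have hat : ∀ u, a ≠ Cut.mk ⊥ u := by
    rintro u rfl
    simp at ha
  unfold essentialValue
  rw [if_neg (hat _), if_neg (hat _)]
  split_ifs with h3 h4
  · simp
  · rw [ha]
    norm_cast
    constructor <;> intros <;> linarith
  · have hbt : (t : EReal) ≤ b.pt := Cut.pt_mono hb
    have htop : b.pt ≠ ⊤ := fun h => by
      rw [← Cut.mk_pt_incl b, h] at h3 h4
      cases hi : b.incl <;> simp [hi] at h3 h4
    lift b.pt to ℝ using ⟨htop, ne_bot_of_le_ne_bot (EReal.coe_ne_bot t) hbt⟩ with β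
    rw [ha, show (2 : EReal) = ((2 : ℝ) : EReal) from rfl, ← EReal.coe_add, ← EReal.coe_div]
    simp only [EReal.coe_le_coe_iff, EReal.coe_eq_coe_iff] at hbt ⊢
    constructor <;> intros <;> linarith

/-- The thresholds of `b` and `a'` are finite, lying between `s` and `t`, and separate the two
values. Equality of the values would force `s = t`. -/
theorem essentialValue_lt {a b a' b' : Cut} (ha : a ≤ Cut.mk s false) (hb : Cut.mk s true ≤ b)
    (h : b ≤ a') (ha' : a' ≤ Cut.mk t false) (hb' : Cut.mk t true ≤ b') :
    essentialValue a b < essentialValue a' b' := by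
  have hst : s < t := EReal.coe_lt_coe_iff.1
    (Cut.mk_true_le_mk_false_iff.1 (hb.trans (h.trans ha')))
  have h1 : (s : EReal) ≤ b.pt := Cut.pt_mono hb
  have h2 : b.pt ≤ a'.pt := Cut.pt_mono h
  have h3 : a'.pt ≤ t := Cut.pt_mono ha'
  obtain ⟨β, hβ⟩ : ∃ β : ℝ, b.pt = β :=
    ⟨b.pt.toReal, (EReal.coe_toReal (ne_top_of_le_ne_top (EReal.coe_ne_top t) (h2.trans h3))
      (ne_bot_of_le_ne_bot (EReal.coe_ne_bot s) h1)).symm⟩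
  obtain ⟨α, hα⟩ : ∃ α : ℝ, a'.pt = α :=
    ⟨a'.pt.toReal, (EReal.coe_toReal (ne_top_of_le_ne_top (EReal.coe_ne_top t) h3)
      (ne_bot_of_le_ne_bot (EReal.coe_ne_bot s) (h1.trans h2))).symm⟩
  have hl := essentialValue_le ha hβ (by rw [hβ] at h1; exact_mod_cast h1)
  have hu := le_essentialValue hb' hα (by rw [hα] at h3; exact_mod_cast h3)
  rw [hβ, hα] at h2
  refine lt_of_le_of_ne (hl.1.trans (h2.trans hu.1)) fun he => ?_
  have e1 : essentialValue a b = β := le_antisymm hl.1 (h2.trans (hu.1.trans he.ge))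
  have e2 : essentialValue a' b' = α := le_antisymm (he.ge.trans (hl.1.trans h2)) hu.1
  have e3 : (β : EReal) = α := by rw [← e1, ← e2, he]
  rw [← hl.2 e1, ← hu.2 e2] at e3
  exact hst.ne (EReal.coe_eq_coe_iff.1 e3)

/-- The essential statistic separates two points exactly when some expert does. -/
theorem essentialValue_lt_iff :
    essentialValue (lowerExpert Δ s) (upperExpert Δ s) <
        essentialValue (lowerExpert Δ t) (upperExpert Δ t) ↔
      ∃ f ∈ Δ, Cut.mk s true ≤ f ∧ f ≤ Cut.mk t false := by
  have key : ∀ {s t : ℝ}, (∃ f ∈ Δ, Cut.mk s true ≤ f ∧ f ≤ Cut.mk t false) →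
      essentialValue (lowerExpert Δ s) (upperExpert Δ s) <
        essentialValue (lowerExpert Δ t) (upperExpert Δ t) := by
    rintro s t ⟨f, hf, hsf, hft⟩
    exact essentialValue_lt (lowerExpert_le Δ s) (le_upperExpert Δ s)
      ((upperExpert_le hf hsf).trans (le_lowerExpert hf hft)) (lowerExpert_le Δ t)
      (le_upperExpert Δ t)
  -- With no expert between them, both points have the same lower and the same upper expert.
  have same : ∀ {s t : ℝ}, s ≤ t → (¬ ∃ f ∈ Δ, Cut.mk s true ≤ f ∧ f ≤ Cut.mk t false) →
      essentialValue (lowerExpert Δ s) (upperExpert Δ s) =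
        essentialValue (lowerExpert Δ t) (upperExpert Δ t) := by
    intro s t hst hno
    have ha : lowerExpert Δ s = lowerExpert Δ t := by
      refine le_antisymm (lowerExpert_mono hst) ((Cut.isLUB_sSup _).2 ?_)
      rintro f (hf | rfl)
      · exact le_lowerExpert hf.1 (Cut.not_mk_true_le_iff.1 fun h => hno ⟨f, hf.1, h, hf.2⟩)
      · exact Cut.bot_le _
    have hb : upperExpert Δ s = upperExpert Δ t := by
      refine le_antisymm (upperExpert_mono hst) ((Cut.isGLB_sInf _).2 ?_)
      rintro f (hf | rfl)
      · refine upperExpert_le hf.1 ?_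
        by_contra h
        exact hno ⟨f, hf.1, hf.2, Cut.not_mk_true_le_iff.1 h⟩
      · exact Cut.le_top _
    rw [ha, hb]
  refine ⟨fun h => ?_, key⟩
  by_contra hno
  rcases le_total s t with hst | hst
  · exact h.ne (same hst hno)
  · by_cases hex : ∃ f ∈ Δ, Cut.mk t true ≤ f ∧ f ≤ Cut.mk s false
    · exact h.not_gt (key hex)
    · exact h.ne (same hst hex).symm

end Essential

/-! ### Votes -/

section Vote

variable {Ω : Type*} [MeasurableSpace Ω] {P : Measure Ω} {T : Ω → ℝ} {Δ : Set Cut}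

theorem measurableSet_mk_true_le (hT : Measurable T) (f : Cut) :
    MeasurableSet {ω | Cut.mk (T ω) true ≤ f} := by
  have h : IsLowerSet {x : ℝ | Cut.mk x true ≤ f} := fun x y hyx hx =>
    (Cut.mk_mono (EReal.coe_le_coe_iff.2 hyx) _).trans hx
  exact hT h.ordConnected.measurableSet

theorem testMean_eq (hT : Measurable T) (f : Cut) :
    testMean P T f = P.real {ω | Cut.mk (T ω) true ≤ f} := by
  classical
  rw [← integral_indicator_one (measurableSet_mk_true_le hT f)]
  refine integral_congr_ae (Filter.Eventually.of_forall fun ω => ?_)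
  simp only [Cut.test_eq, indicator_apply, mem_ofPred_eq, Pi.one_apply]

theorem measurableSet_coe_Iio (f : Δ) : MeasurableSet (Iio f) :=
  measurable_subtype_coe (measurableSet_Iio (a := (f : Cut)))

theorem measurableSet_coe_Iic (f : Δ) : MeasurableSet (Iic f) :=
  measurable_subtype_coe (measurableSet_Iic (a := (f : Cut)))

/-- The weight is the law of the largest expert rejecting `T`: it is below `f` exactly when `f`
accepts `T`. The join with `sInf Δ` supplies an expert where none rejects, without changing the
comparison with any `f ≠ sInf Δ`. -/
theorem exists_isLeftWeight [IsProbabilityMeasure P] (hT : Measurable T) (hΔ : IsClosed Δ)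
    (hne : Δ.Nonempty) : ∃ m : Measure Δ, IsLeftWeight P T Δ m := by
  have hinf : sInf Δ ∈ Δ := (Cut.isGLB_sInf Δ).mem_of_isClosed hne hΔ
  have hmem : ∀ t : ℝ, lowerExpert Δ t ⊔ sInf Δ ∈ Δ := fun t => by
    by_cases h : ∃ f ∈ Δ, f ≤ Cut.mk t false
    · have h' := lowerExpert_mem hΔ h
      rwa [sup_eq_left.2 ((Cut.isGLB_sInf Δ).1 h')]
    · refine (sup_eq_right.2 ((Cut.isLUB_sSup _).2 ?_)).symm ▸ hinf
      rintro f (hf | rfl)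
      exacts [absurd ⟨f, hf⟩ h, Cut.bot_le _]
  have hmono : Monotone fun t : ℝ => lowerExpert Δ t ⊔ sInf Δ := fun s t hst =>
    sup_le_sup_right (lowerExpert_mono hst) _
  have hg : Measurable fun ω => (⟨_, hmem (T ω)⟩ : Δ) :=
    ((Cut.measurable_of_monotone hmono).comp hT).subtype_mk
  refine ⟨P.map fun ω => ⟨_, hmem (T ω)⟩, Measure.isProbabilityMeasure_map hg.aemeasurable,
    fun f hf => ?_⟩
  rw [map_measureReal_apply hg (measurableSet_coe_Iio _), testMean_eq hT]
  congr 1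
  ext ω
  have hlt : sInf Δ < f := lt_of_le_of_ne ((Cut.isGLB_sInf Δ).1 f.2) (Ne.symm hf)
  simp only [mem_preimage, mem_Iio, mem_ofPred_eq, ← Subtype.coe_lt_coe, sup_lt_iff, hlt, and_true]
  rw [← not_le, ← not_iff_not, not_not, Cut.not_mk_true_le_iff]
  exact ⟨fun h => h.trans (lowerExpert_le _ _), fun h => le_lowerExpert f.2 h⟩

/-- Dually, the weight is the law of the smallest expert accepting `T`, capped at `sSup Δ`. -/
theorem exists_isRightWeight [IsProbabilityMeasure P] (hT : Measurable T) (hΔ : IsClosed Δ)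
    (hne : Δ.Nonempty) : ∃ m : Measure Δ, IsRightWeight P T Δ m := by
  have hsup : sSup Δ ∈ Δ := (Cut.isLUB_sSup Δ).mem_of_isClosed hne hΔ
  have hmem : ∀ t : ℝ, upperExpert Δ t ⊓ sSup Δ ∈ Δ := fun t => by
    by_cases h : ∃ f ∈ Δ, Cut.mk t true ≤ f
    · have h' := upperExpert_mem hΔ h
      rwa [inf_eq_left.2 ((Cut.isLUB_sSup Δ).1 h')]
    · refine (inf_eq_right.2 ((Cut.isGLB_sInf _).2 ?_)).symm ▸ hsup
      rintro f (hf | rfl)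
      exacts [absurd ⟨f, hf⟩ h, Cut.le_top _]
  have hmono : Monotone fun t : ℝ => upperExpert Δ t ⊓ sSup Δ := fun s t hst =>
    inf_le_inf_right _ (upperExpert_mono hst)
  have hg : Measurable fun ω => (⟨_, hmem (T ω)⟩ : Δ) :=
    ((Cut.measurable_of_monotone hmono).comp hT).subtype_mk
  refine ⟨P.map fun ω => ⟨_, hmem (T ω)⟩, Measure.isProbabilityMeasure_map hg.aemeasurable,
    fun f hf => ?_⟩
  rw [map_measureReal_apply hg (measurableSet_coe_Iic _), testMean_eq hT]
  congr 1
  ext ω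
  have hlt : ¬ sSup Δ ≤ f := not_le.2 (lt_of_le_of_ne ((Cut.isLUB_sSup Δ).1 f.2) hf)
  simp only [mem_preimage, mem_Iic, mem_ofPred_eq, ← Subtype.coe_le_coe, inf_le_iff, hlt, or_false]
  exact ⟨fun h => (le_upperExpert _ _).trans h, fun h => upperExpert_le f.2 h⟩

theorem voteFrequency_eq (m m' : Measure Δ) [IsFiniteMeasure m] [IsFiniteMeasure m'] (x : ℝ) :
    voteFrequency m m' x = (m.real {f | Cut.mk x true ≤ f} + m'.real {f | Cut.mk x true ≤ f}) / 2 := by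
  classical
  have hS : MeasurableSet {f : Δ | Cut.mk x true ≤ f} := measurable_subtype_coe measurableSet_Ici
  have hfun : (fun f : Δ => (f : Cut).test x) = {f : Δ | Cut.mk x true ≤ f}.indicator 1 := by
    ext f
    simp only [Cut.test_eq, indicator_apply, mem_ofPred_eq, Pi.one_apply]
  unfold voteFrequency
  rw [hfun, integral_indicator_one hS, measureReal_ennreal_smul_apply, measureReal_add_apply]
  simp
  ring

/-- The result of the vote is given by the mid-distribution function of the essential statistic,
wherever experts exist on both sides. -/
theorem isVote_essentialValue [IsProbabilityMeasure P] (hT : Measurable T) (hΔ : IsClosed Δ)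
    {x : ℝ} (ha : lowerExpert Δ x ∈ Δ) (hb : upperExpert Δ x ∈ Δ) :
    IsVote P T Δ x (1 - midCDF P
      (fun ω => essentialValue (lowerExpert Δ (T ω)) (upperExpert Δ (T ω)))
      (essentialValue (lowerExpert Δ x) (upperExpert Δ x))) := by
  refine ⟨exists_isLeftWeight hT hΔ ⟨_, ha⟩, exists_isRightWeight hT hΔ ⟨_, ha⟩,
    fun m m' hm hm' => ?_⟩
  have := hm.prob
  have := hm'.prob
  have hab : lowerExpert Δ x < upperExpert Δ x :=
    (lowerExpert_le Δ x).trans_lt ((Cut.mk_false_lt_mk_true _).trans_le (le_upperExpert Δ x))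
  -- No expert lies strictly between the lower and the upper expert at `x`. The experts accepting
  -- `x` therefore form the complement of a ray ending at either one, and the two weights are given
  -- on these rays.
  have h1 : {f : Δ | Cut.mk x true ≤ f} = (Iio ⟨_, hb⟩)ᶜ := by
    ext f
    simp only [mem_ofPred_eq, mem_compl_iff, mem_Iio, not_lt, ← Subtype.coe_le_coe]
    exact ⟨fun h => upperExpert_le f.2 h, fun h => (le_upperExpert _ _).trans h⟩
  have h2 : {f : Δ | Cut.mk x true ≤ f} = (Iic ⟨_, ha⟩)ᶜ := by
    ext f
    simp only [mem_ofPred_eq, mem_compl_iff, mem_Iic, ← Subtype.coe_le_coe]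
    rw [← not_iff_not, not_not, Cut.not_mk_true_le_iff]
    exact ⟨fun h => le_lowerExpert f.2 h, fun h => h.trans (lowerExpert_le _ _)⟩
  have e1 : m.real {f : Δ | Cut.mk x true ≤ f} = 1 - testMean P T (upperExpert Δ x) := by
    rw [h1, probReal_compl_eq_one_sub (measurableSet_coe_Iio _),
      hm.ray ⟨_, hb⟩ (((Cut.isGLB_sInf Δ).1 ha).trans_lt hab).ne']
  have e2 : m'.real {f : Δ | Cut.mk x true ≤ f} = 1 - testMean P T (lowerExpert Δ x) := by
    rw [h2, probReal_compl_eq_one_sub (measurableSet_coe_Iic _),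
      hm'.ray ⟨_, ha⟩ (hab.trans_le ((Cut.isLUB_sSup Δ).1 hb)).ne]
  have hlt : {ω | essentialValue (lowerExpert Δ (T ω)) (upperExpert Δ (T ω)) <
      essentialValue (lowerExpert Δ x) (upperExpert Δ x)} =
      {ω | Cut.mk (T ω) true ≤ lowerExpert Δ x} := by
    ext ω
    simp only [mem_ofPred_eq, essentialValue_lt_iff]
    exact ⟨fun ⟨f, hf, h, h'⟩ => h.trans (le_lowerExpert hf h'),
      fun h => ⟨_, ha, h, lowerExpert_le _ _⟩⟩
  have hle : {ω | essentialValue (lowerExpert Δ (T ω)) (upperExpert Δ (T ω)) ≤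
      essentialValue (lowerExpert Δ x) (upperExpert Δ x)} =
      {ω | Cut.mk (T ω) true ≤ upperExpert Δ x} := by
    ext ω
    simp only [mem_ofPred_eq]
    rw [← not_iff_not, not_le, Cut.not_mk_true_le_iff, essentialValue_lt_iff]
    exact ⟨fun ⟨f, hf, h, h'⟩ => (upperExpert_le hf h).trans h',
      fun h => ⟨_, hb, le_upperExpert _ _, h⟩⟩
  rw [voteFrequency_eq, e1, e2, midCDF, hlt, hle, testMean_eq hT, testMean_eq hT]
  ring

end Vote

/-! ### Experts and normalized families -/

section Experts

variable {Ω Θ : Type*} {Θ₀ Θ₁ : Set Θ} {h : Θ → Θ → ℝ → ℝ≥0∞}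

open Classical in
theorem simpleTest_eq (g : ℝ → ℝ≥0∞) (k : ℝ≥0∞) (β : Bool) (x : ℝ) :
    simpleTest g k β x = if g x < k ∨ (β = true ∧ g x = k) then 1 else 0 := by
  unfold simpleTest
  by_cases h1 : g x < k
  · simp [h1, h1.ne]
  · simp [h1]

theorem exists_mem_simpleTests {g : ℝ → ℝ≥0∞} (hg : Monotone g) {k : ℝ≥0∞} {β : Bool}
    (hk : IsSimpleIndex k β) :
    ∃ c ∈ simpleTests g, ∀ x : ℝ, Cut.mk x true ≤ c ↔ g x < k ∨ (β = true ∧ g x = k) := by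
  classical
  obtain ⟨c, hc, hcx⟩ := Cut.exists_threshold_of_isLowerSet
    (L := {x | g x < k ∨ (β = true ∧ g x = k)}) (by
      rintro x y hyx (hx | hx)
      · exact Or.inl ((hg hyx).trans_lt hx)
      · rcases (hg hyx).lt_or_eq with h | h
        · exact Or.inl (h.trans_eq hx.2)
        · exact Or.inr ⟨hx.1, h.trans hx.2⟩)
  refine ⟨c, ⟨hc, k, β, hk, fun x => ?_⟩, hcx⟩
  rw [Cut.test_eq, simpleTest_eq]
  exact if_congr (hcx x) rfl rfl

theorem mem_simpleTests_iff {g : ℝ → ℝ≥0∞} {c : Cut} (hc : c ∈ simpleTests g) :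
    ∃ k β, IsSimpleIndex k β ∧ ∀ x : ℝ, Cut.mk x true ≤ c ↔ g x < k ∨ (β = true ∧ g x = k) := by
  classical
  obtain ⟨-, k, β, hk, hx⟩ := hc
  refine ⟨k, β, hk, fun x => ?_⟩
  have := hx x
  rw [Cut.test_eq, simpleTest_eq] at this
  split_ifs at this with h1 h2 h2
  · exact iff_of_true h1 h2
  · simp at this
  · simp at this
  · exact iff_of_false h1 h2

theorem mem_allSimpleTests {c : Cut} :
    c ∈ allSimpleTests Θ₀ Θ₁ h ↔ ∃ θ₀ ∈ Θ₀, ∃ θ₁ ∈ Θ₁, c ∈ simpleTests (h θ₀ θ₁) := by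
  simp [allSimpleTests]

/-- Two points are separated by an expert exactly when some ratio of the family separates them. -/
theorem exists_mem_experts_iff (hmono : ∀ θ₀ ∈ Θ₀, ∀ θ₁ ∈ Θ₁, Monotone (h θ₀ θ₁)) {s t : ℝ} :
    (∃ f ∈ experts Θ₀ Θ₁ h, Cut.mk s true ≤ f ∧ f ≤ Cut.mk t false) ↔
      ∃ θ₀ ∈ Θ₀, ∃ θ₁ ∈ Θ₁, h θ₀ θ₁ s < h θ₀ θ₁ t := by
  constructor
  · rintro ⟨f, hf, hsf, hft⟩
    -- By adjacency this open interval is the closed one from `(s, 1)` to `(t, 0)`. A limit of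
    -- simple tests in it can be replaced by a simple test.
    have hopen : Ioo (Cut.mk s false) (Cut.mk t true) ∈ nhds f :=
      isOpen_Ioo.mem_nhds ⟨(Cut.mk_false_lt_mk_true _).trans_le hsf, Cut.lt_mk_true_iff.2 hft⟩
    obtain ⟨c, ⟨hsc, hct⟩, hc⟩ := mem_closure_iff_nhds.1 hf _ hopen
    rw [← not_le, ← Cut.not_mk_true_le_iff, not_not] at hsc
    rw [← not_le] at hct
    obtain ⟨θ₀, h₀, θ₁, h₁, hc⟩ := mem_allSimpleTests.1 hc
    obtain ⟨k, β, -, hx⟩ := mem_simpleTests_iff hc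
    rw [hx] at hsc hct
    rw [not_or, not_lt] at hct
    refine ⟨θ₀, h₀, θ₁, h₁, ?_⟩
    rcases hsc with hsc | hsc
    · exact hsc.trans_le hct.1
    · exact lt_of_le_of_ne (hsc.2.trans_le hct.1) fun e => hct.2 ⟨hsc.1, e ▸ hsc.2⟩
  · rintro ⟨θ₀, h₀, θ₁, h₁, hlt⟩
    -- The test `h ≤ h s` accepts `s` and rejects `t`. Its index is admissible even if `h s = 0`,
    -- because `β = 1`, and `h s < h t` excludes `∞`.
    have hk : IsSimpleIndex (h θ₀ θ₁ s) true := by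
      rcases eq_or_ne (h θ₀ θ₁ s) 0 with h0 | h0
      · exact Or.inl ⟨h0, rfl⟩
      · exact Or.inr (Or.inl ⟨pos_iff_ne_zero.2 h0, hlt.trans_le le_top⟩)
    obtain ⟨c, hc, hx⟩ := exists_mem_simpleTests (hmono θ₀ h₀ θ₁ h₁) hk
    refine ⟨c, subset_closure (mem_allSimpleTests.2 ⟨θ₀, h₀, θ₁, h₁, hc⟩), ?_, ?_⟩
    · rw [hx]
      exact Or.inr ⟨rfl, rfl⟩
    · rw [← Cut.not_mk_true_le_iff, hx]
      simp [hlt.not_gt, hlt.ne']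

theorem essentialFun_lt_iff (hmono : ∀ θ₀ ∈ Θ₀, ∀ θ₁ ∈ Θ₁, Monotone (h θ₀ θ₁)) {s t : ℝ} :
    essentialFun Θ₀ Θ₁ h s < essentialFun Θ₀ Θ₁ h t ↔
      ∃ θ₀ ∈ Θ₀, ∃ θ₁ ∈ Θ₁, h θ₀ θ₁ s < h θ₀ θ₁ t :=
  essentialValue_lt_iff.trans (exists_mem_experts_iff hmono)

/-- The simple test of index `(0, 1)` rejects every point where the ratio is positive. Index `(∞,
0)` plays the dual role for the upper expert. -/
theorem lowerExpert_experts_mem (hmono : ∀ θ₀ ∈ Θ₀, ∀ θ₁ ∈ Θ₁, Monotone (h θ₀ θ₁)) {t : ℝ}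
    {θ₀ θ₁ : Θ} (h₀ : θ₀ ∈ Θ₀) (h₁ : θ₁ ∈ Θ₁) (ht : h θ₀ θ₁ t ≠ 0) :
    lowerExpert (experts Θ₀ Θ₁ h) t ∈ experts Θ₀ Θ₁ h := by
  obtain ⟨c, hc, hx⟩ := exists_mem_simpleTests (hmono θ₀ h₀ θ₁ h₁) (Or.inl ⟨rfl, rfl⟩)
  refine lowerExpert_mem isClosed_closure
    ⟨c, subset_closure (mem_allSimpleTests.2 ⟨θ₀, h₀, θ₁, h₁, hc⟩), ?_⟩
  rw [← Cut.not_mk_true_le_iff, hx]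
  simp [ht]

theorem upperExpert_experts_mem (hmono : ∀ θ₀ ∈ Θ₀, ∀ θ₁ ∈ Θ₁, Monotone (h θ₀ θ₁)) {t : ℝ}
    {θ₀ θ₁ : Θ} (h₀ : θ₀ ∈ Θ₀) (h₁ : θ₁ ∈ Θ₁) (ht : h θ₀ θ₁ t ≠ ∞) :
    upperExpert (experts Θ₀ Θ₁ h) t ∈ experts Θ₀ Θ₁ h := by
  obtain ⟨c, hc, hx⟩ := exists_mem_simpleTests (hmono θ₀ h₀ θ₁ h₁) (Or.inr (Or.inr ⟨rfl, rfl⟩))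
  refine upperExpert_mem isClosed_closure
    ⟨c, subset_closure (mem_allSimpleTests.2 ⟨θ₀, h₀, θ₁, h₁, hc⟩), ?_⟩
  rw [hx]
  exact Or.inl (lt_top_iff_ne_top.2 ht)

open Classical in
/-- Normalized families exist in models with monotone likelihood ratio. -/
theorem exists_isNormalizedFamily {p : Θ → Ω → ℝ≥0} {T : Ω → ℝ}
    (hr : ∀ θ₀ ∈ Θ₀, ∀ θ₁ ∈ Θ₁, ∃ g : ℝ → ℝ≥0∞, Monotone g ∧ IsRatio (p θ₀) (p θ₁) T g) :
    ∃ h : Θ → Θ → ℝ → ℝ≥0∞, IsNormalizedFamily p T Θ₀ Θ₁ h := by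
  -- This is the running supremum of the observed ratios. Any monotone version of the ratio shows
  -- that it has the right values, and it stays constant where both densities vanish since such
  -- points do not enter.
  let r : Θ → Θ → ℝ → ℝ≥0∞ := fun θ₀ θ₁ t =>
    ⨆ ω, ⨆ (_ : T ω ≤ t ∧ ¬ (p θ₀ ω = 0 ∧ p θ₁ ω = 0)), (p θ₀ ω : ℝ≥0∞) / (p θ₁ ω : ℝ≥0∞)
  have hrmono : ∀ θ₀ θ₁, Monotone (r θ₀ θ₁) := fun θ₀ θ₁ x y hxy =>
    iSup_mono fun ω => iSup_mono' fun h => ⟨⟨h.1.trans hxy, h.2⟩, le_rfl⟩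
  let h : Θ → Θ → ℝ → ℝ≥0∞ := fun θ₀ θ₁ t =>
    if t ∈ upperNull p T Θ₁ then ∞ else if t ∈ lowerNull p T Θ₀ then 0 else r θ₀ θ₁ t
  refine ⟨h, ?_, ?_, ?_, ?_, ?_⟩
  · intro θ₀ h₀ θ₁ h₁ x y hxy
    by_cases hy : y ∈ upperNull p T Θ₁
    · simp [h, hy]
    have hx : x ∉ upperNull p T Θ₁ := fun hx => hy fun ω hω => hx ω (hxy.trans hω)
    by_cases hx' : x ∈ lowerNull p T Θ₀
    · simp [h, hx, hx']
    have hy' : y ∉ lowerNull p T Θ₀ := fun hy' => hx' fun ω hω => hy' ω (hω.trans hxy)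
    simpa [h, hx, hy, hx', hy'] using hrmono θ₀ θ₁ hxy
  · intro θ₀ h₀ θ₁ h₁ ω hω
    obtain ⟨g, hg, hgr⟩ := hr θ₀ h₀ θ₁ h₁
    by_cases hu : T ω ∈ upperNull p T Θ₁
    · have h1 : p θ₁ ω = 0 := hu ω le_rfl θ₁ h₁
      have h0 : p θ₀ ω ≠ 0 := fun h0 => hω ⟨h0, h1⟩
      simp [h, hu, h1, ENNReal.div_zero, h0]
    by_cases hl : T ω ∈ lowerNull p T Θ₀
    · have h0 : p θ₀ ω = 0 := hl ω le_rfl θ₀ h₀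
      simp [h, hu, hl, h0]
    simp only [h, hu, hl, if_false]
    refine le_antisymm (le_iSup₂_of_le ω ⟨le_rfl, hω⟩ le_rfl) (iSup₂_le fun ω' hω' => ?_)
    rw [hgr ω' hω'.2, hgr ω hω]
    exact hg hω'.1
  · intro θ₀ h₀ θ₁ h₁ I hI hsub hnull
    have key : ∀ x ∈ I, ∀ y ∈ I, x ≤ y → h θ₀ θ₁ x = h θ₀ θ₁ y := by
      intro x hx y hy hxy
      have hx' := hsub hx
      have hy' := hsub hy
      simp only [mem_compl_iff, mem_union, not_or] at hx' hy'
      simp only [h, hx'.1, hx'.2, hy'.1, hy'.2, if_false]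
      refine le_antisymm (hrmono θ₀ θ₁ hxy) (iSup₂_le fun ω hω => ?_)
      refine le_iSup₂_of_le ω ⟨le_of_not_gt fun hlt => ?_, hω.2⟩ le_rfl
      exact hω.2 (hnull ω (hI.out hx hy ⟨hlt.le, hω.1⟩))
    intro x hx y hy
    rcases le_total x y with hxy | hxy
    exacts [key x hx y hy hxy, (key y hy x hx hxy).symm]
  · intro θ₀ h₀ θ₁ h₁ t ht
    simp [h, ht]
  · intro θ₀ h₀ θ₁ h₁ t ht
    simp [h, ht.1, ht.2]

end Experts

/-! ### The universal statistic -/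

/-- The classes of a convex equivalence relation on a set of real numbers are separated by
a nondecreasing function that is constant on each of them. -/
theorem exists_monotone_lt_iff_not {S : Set ℝ} {r : ℝ → ℝ → Prop} (hrefl : ∀ s, r s s)
    (hsymm : ∀ {s t}, r s t → r t s) (htrans : ∀ {s t u}, t ∈ S → r s t → r t u → r s u)
    (hconv : ∀ {s t u}, s ≤ t → t ≤ u → r s u → r s t ∧ r t u) :
    ∃ K : ℝ → EReal, Monotone K ∧ ∀ s ∈ S, ∀ t ∈ S, s < t → (K s < K t ↔ ¬ r s t) := by
  -- The map `arctan` makes the classes bounded, so that each has a real infimum and supremum whose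
  -- midpoint can label it.
  let C : ℝ → Set ℝ := fun t => Real.arctan '' {x ∈ S | r t x}
  let k : ℝ → ℝ := fun t => (sInf (C t) + sSup (C t)) / 2
  have hbelow : ∀ t, BddBelow (C t) := fun t => ⟨-(Real.pi / 2), by
    rintro _ ⟨x, -, rfl⟩
    exact (Real.neg_pi_div_two_lt_arctan x).le⟩
  have habove : ∀ t, BddAbove (C t) := fun t => ⟨Real.pi / 2, by
    rintro _ ⟨x, -, rfl⟩
    exact (Real.arctan_lt_pi_div_two x).le⟩
  have hmem : ∀ t ∈ S, Real.arctan t ∈ C t := fun t ht => ⟨t, ⟨ht, hrefl t⟩, rfl⟩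
  have heq : ∀ s ∈ S, ∀ t ∈ S, r s t → k s = k t := by
    intro s hs t ht hst
    have : C s = C t := by
      refine congrArg (fun A => Real.arctan '' A) (Set.ext fun x => and_congr_right fun hx => ?_)
      exact ⟨fun h => htrans hs (hsymm hst) h, fun h => htrans ht hst h⟩
    simp only [k, this]
  have hlt : ∀ s ∈ S, ∀ t ∈ S, s < t → ¬ r s t → k s < k t := by
    intro s hs t ht hst hno
    have hle : sSup (C s) ≤ sInf (C t) := by
      refine csSup_le ⟨_, hmem s hs⟩ ?_
      rintro _ ⟨x, ⟨hxS, hx⟩, rfl⟩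
      refine le_csInf ⟨_, hmem t ht⟩ ?_
      rintro _ ⟨y, ⟨hyS, hy⟩, rfl⟩
      refine Real.arctan_strictMono.monotone (le_of_not_gt fun hyx => hno ?_)
      rcases le_total y s with hys | hsy
      · exact (hconv hys hst.le (hsymm hy)).2
      · exact htrans hyS (hconv hsy hyx.le hx).1 (hsymm hy)
    -- The bound `hle` alone gives a weak inequality of midpoints; `arctan s < arctan t` makes the
    -- sum of the outer endpoints strict.
    have h1 := csInf_le (hbelow s) (hmem s hs)
    have h2 := le_csSup (habove t) (hmem t ht)
    have h3 := Real.arctan_strictMono hst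
    simp only [k]
    linarith
  have hmono : ∀ s ∈ S, ∀ t ∈ S, s ≤ t → k s ≤ k t := by
    intro s hs t ht hst
    by_cases h : r s t
    · exact (heq s hs t ht h).le
    · exact (hlt s hs t ht (lt_of_le_of_ne hst fun e => h (e ▸ hrefl s)) h).le
  -- Extension from `S` to the line by a running supremum, with value `-∞` where no point of `S`
  -- precedes.
  let K : ℝ → EReal := fun t => ⨆ s, ⨆ (_ : s ∈ S ∧ s ≤ t), (k s : EReal)
  have hK : ∀ t ∈ S, K t = k t := fun t ht =>
    le_antisymm (iSup₂_le fun s hs => EReal.coe_le_coe_iff.2 (hmono s hs.1 t ht hs.2))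
      (le_iSup₂_of_le t ⟨ht, le_rfl⟩ le_rfl)
  refine ⟨K, fun s t hst => iSup_mono fun x => iSup_mono' fun h => ⟨⟨h.1, h.2.trans hst⟩, le_rfl⟩,
    fun s hs t ht hst => ?_⟩
  rw [hK s hs, hK t ht, EReal.coe_lt_coe_iff]
  exact ⟨fun h hr => h.ne (heq s hs t ht hr), hlt s hs t ht hst⟩

/-! ### Proportionality of the densities above an interval -/

section Model

variable {Ω Θ : Type*} {p : Θ → Ω → ℝ≥0} {T : Ω → ℝ}

/-- Two points are indistinguishable if all the densities are proportional to each other above the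
interval that they bound. -/
def Indistinguishable (p : Θ → Ω → ℝ≥0) (T : Ω → ℝ) (s t : ℝ) : Prop :=
  s = t ∨ ∃ (c : Θ → ℝ≥0) (q : Ω → ℝ≥0), ∀ ω, T ω ∈ uIcc s t → ∀ θ, p θ ω = c θ * q ω

theorem exists_ne_zero_of_notMem_totallyNull {t : ℝ} (ht : t ∉ totallyNull p T) :
    ∃ ω, T ω = t ∧ ∃ θ, p θ ω ≠ 0 := by
  by_contra! h
  exact ht h

namespace Indistinguishable

theorem symm {s t : ℝ} (h : Indistinguishable p T s t) : Indistinguishable p T t s := by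
  rcases h with h | h
  · exact Or.inl h.symm
  · rw [uIcc_comm] at h
    exact Or.inr h

/-- A density positive at some `ω₀` above `t` normalizes both factorizations to the same one. Above
a totally null `t` nothing would link their constants. -/
theorem trans {s t u : ℝ} (ht : t ∉ totallyNull p T) (h : Indistinguishable p T s t)
    (h' : Indistinguishable p T t u) : Indistinguishable p T s u := by
  rcases h with rfl | ⟨c, q, hq⟩
  · exact h'
  rcases h' with rfl | ⟨c', q', hq'⟩
  · exact Or.inr ⟨c, q, hq⟩
  obtain ⟨ω₀, hω₀, θ, hθ⟩ := exists_ne_zero_of_notMem_totallyNull ht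
  have e1 := hq ω₀ (hω₀ ▸ right_mem_uIcc)
  have e2 := hq' ω₀ (hω₀ ▸ left_mem_uIcc)
  have key : ∀ (d : Θ → ℝ≥0) (r : Ω → ℝ≥0) (ω : Ω), (∀ θ, p θ ω₀ = d θ * r ω₀) →
      (∀ θ, p θ ω = d θ * r ω) → ∀ θ', p θ' ω = p θ' ω₀ / p θ ω₀ * p θ ω := by
    intro d r ω h0 h1 θ'
    have hne : d θ ≠ 0 ∧ r ω₀ ≠ 0 := by
      rw [h0] at hθ
      exact ⟨left_ne_zero_of_mul hθ, right_ne_zero_of_mul hθ⟩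
    rw [h0, h0, h1, h1]
    have := hne.1
    have := hne.2
    field_simp
  refine Or.inr ⟨fun θ' => p θ' ω₀ / p θ ω₀, p θ, fun ω hω => ?_⟩
  rcases uIcc_subset_uIcc_union_uIcc (b := t) hω with h | h
  · exact key c q ω e1 (hq ω h)
  · exact key c' q' ω e2 (hq' ω h)

theorem of_le_of_le {s t u : ℝ} (hst : s ≤ t) (htu : t ≤ u) (h : Indistinguishable p T s u) :
    Indistinguishable p T s t ∧ Indistinguishable p T t u := by
  rcases h with rfl | ⟨c, q, hq⟩
  · obtain rfl := le_antisymm hst htu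
    exact ⟨Or.inl rfl, Or.inl rfl⟩
  · have hmem : t ∈ uIcc s u := mem_uIcc_of_le hst htu
    exact ⟨Or.inr ⟨c, q, fun ω hω => hq ω (uIcc_subset_uIcc_left hmem hω)⟩,
      Or.inr ⟨c, q, fun ω hω => hq ω (uIcc_subset_uIcc_right hmem hω)⟩⟩

end Indistinguishable

/-- A positive density above `s` makes `q` nonzero there, so `c θ = 0` for every `θ ∈ A`. These
densities would then vanish up to `t`, putting `t` in the null half-line. -/
theorem not_indistinguishable_of_mem_lowerNull {A : Set Θ} {s t : ℝ} (hst : s < t)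
    (hs : s ∈ lowerNull p T A) (hsN : s ∉ totallyNull p T) (ht : t ∉ lowerNull p T A) :
    ¬ Indistinguishable p T s t := by
  rintro (h | ⟨c, q, hq⟩)
  · exact hst.ne h
  obtain ⟨ω₀, hω₀, θ, hθ⟩ := exists_ne_zero_of_notMem_totallyNull hsN
  have e := hq ω₀ (hω₀ ▸ left_mem_uIcc)
  refine ht fun ω hω θ' hθ' => ?_
  rcases le_total (T ω) s with h | h
  · exact hs ω h θ' hθ'
  rw [e] at hθ
  have h0 := hs ω₀ hω₀.le θ' hθ'
  rw [e, mul_eq_zero, or_iff_left (right_ne_zero_of_mul hθ)] at h0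
  rw [hq ω (mem_uIcc_of_le h hω), h0, zero_mul]

theorem not_indistinguishable_of_mem_upperNull {A : Set Θ} {s t : ℝ} (hst : s < t)
    (ht : t ∈ upperNull p T A) (htN : t ∉ totallyNull p T) (hs : s ∉ upperNull p T A) :
    ¬ Indistinguishable p T s t := by
  rintro (h | ⟨c, q, hq⟩)
  · exact hst.ne h
  obtain ⟨ω₀, hω₀, θ, hθ⟩ := exists_ne_zero_of_notMem_totallyNull htN
  have e := hq ω₀ (hω₀ ▸ right_mem_uIcc)
  refine hs fun ω hω θ' hθ' => ?_
  rcases le_total t (T ω) with h | h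
  · exact ht ω h θ' hθ'
  rw [e] at hθ
  have h0 := ht ω₀ hω₀.ge θ' hθ'
  rw [e, mul_eq_zero, or_iff_left (right_ne_zero_of_mul hθ)] at h0
  rw [hq ω (mem_uIcc_of_le hω h), h0, zero_mul]

/-- With `0 / 0` excluded, a quotient is infinite exactly when its denominator is zero, so the
denominators vanish together. -/
theorem mul_eq_mul_of_ennreal_div_eq_div {a b a' b' : ℝ≥0} (h : ¬ (a = 0 ∧ b = 0))
    (h' : ¬ (a' = 0 ∧ b' = 0)) (e : (a : ℝ≥0∞) / b = a' / b') : a * b' = a' * b := by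
  by_cases hb : b = 0
  · have ha : a ≠ 0 := fun ha => h ⟨ha, hb⟩
    by_cases hb' : b' = 0
    · simp [hb, hb']
    · rw [hb, ← ENNReal.coe_div hb', ENNReal.coe_zero, ENNReal.div_zero (by simpa using ha)] at e
      exact absurd e.symm ENNReal.coe_ne_top
  · by_cases hb' : b' = 0
    · have ha' : a' ≠ 0 := fun ha => h' ⟨ha, hb'⟩
      rw [hb', ← ENNReal.coe_div hb, ENNReal.coe_zero, ENNReal.div_zero (by simpa using ha')] at e
      exact absurd e ENNReal.coe_ne_top
    · rw [← ENNReal.coe_div hb, ← ENNReal.coe_div hb', ENNReal.coe_inj] at e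
      exact (div_eq_div_iff hb hb').1 e

/-! ### Normalized ratios and indistinguishability -/

namespace IsNormalizedFamily

variable {Θ₀ Θ₁ : Set Θ} {h : Θ → Θ → ℝ → ℝ≥0∞} {s t : ℝ}

/-- A density of `Θ₀` positive at or before `t` has positive ratios there against every `θ₁`, and
monotonicity carries this to `t`. -/
theorem exists_ne_zero (hh : IsNormalizedFamily p T Θ₀ Θ₁ h) (ht : t ∉ lowerNull p T Θ₀) :
    ∃ θ₀ ∈ Θ₀, ∀ θ₁ ∈ Θ₁, h θ₀ θ₁ t ≠ 0 := by
  simp only [lowerNull, mem_ofPred_eq, not_forall] at ht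
  obtain ⟨ω, hω, θ₀, h₀, hne⟩ := ht
  refine ⟨θ₀, h₀, fun θ₁ h₁ hz => ?_⟩
  have h1 := hh.mono θ₀ h₀ θ₁ h₁ hω
  rw [hz, ← hh.ratio θ₀ h₀ θ₁ h₁ ω fun h => hne h.1, nonpos_iff_eq_zero, ENNReal.div_eq_zero_iff] at h1
  simp [hne] at h1

theorem exists_ne_top (hh : IsNormalizedFamily p T Θ₀ Θ₁ h) (ht : t ∉ upperNull p T Θ₁) :
    ∃ θ₁ ∈ Θ₁, ∀ θ₀ ∈ Θ₀, h θ₀ θ₁ t ≠ ∞ := by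
  simp only [upperNull, mem_ofPred_eq, not_forall] at ht
  obtain ⟨ω, hω, θ₁, h₁, hne⟩ := ht
  refine ⟨θ₁, h₁, fun θ₀ h₀ hz => ?_⟩
  have h1 := hh.mono θ₀ h₀ θ₁ h₁ hω
  rw [hz, ← hh.ratio θ₀ h₀ θ₁ h₁ ω fun h => hne h.2, top_le_iff, ENNReal.div_eq_top] at h1
  simp [hne] at h1

/-- Off the null sets, some densities of both hypotheses are positive at the same point. -/
theorem exists_ne_zero_and_ne_zero (hh : IsNormalizedFamily p T Θ₀ Θ₁ h) (hun : Θ₁ ∪ Θ₀ = univ)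
    (hi : t ∉ lowerNull p T Θ₀) (hs : t ∉ upperNull p T Θ₁) (hN : t ∉ totallyNull p T) :
    ∃ ω, T ω = t ∧ ∃ θ₀ ∈ Θ₀, ∃ θ₁ ∈ Θ₁, p θ₀ ω ≠ 0 ∧ p θ₁ ω ≠ 0 := by
  obtain ⟨ω, rfl, θ, hθ⟩ := exists_ne_zero_of_notMem_totallyNull hN
  refine ⟨ω, rfl, ?_⟩
  rcases hun.ge (mem_univ θ) with hm | hm
  · obtain ⟨θ₀, h₀, hne⟩ := hh.exists_ne_zero hi
    refine ⟨θ₀, h₀, θ, hm, fun hz => hne θ hm ?_, hθ⟩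
    rw [← hh.ratio θ₀ h₀ θ hm ω fun h => hθ h.2, hz]
    simp
  · obtain ⟨θ₁, h₁, hne⟩ := hh.exists_ne_top hs
    refine ⟨θ, hm, θ₁, h₁, hθ, fun hz => hne θ hm ?_⟩
    rw [← hh.ratio θ hm θ₁ h₁ ω fun h => hθ h.1, hz, ENNReal.coe_zero]
    exact ENNReal.div_zero (by simpa using hθ)

/-- If `c θ₀` and `c θ₁` are not both zero, the ratio at each endpoint is `c θ₀ / c θ₁`. If both
vanish, the ratio is unconstrained by the densities and normalization makes it constant. -/
theorem not_lt_of_indistinguishable (hh : IsNormalizedFamily p T Θ₀ Θ₁ h)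
    (hsub : Icc s t ⊆ (lowerNull p T Θ₀ ∪ upperNull p T Θ₁)ᶜ) (hst : s ≤ t)
    (hsN : s ∉ totallyNull p T) (htN : t ∉ totallyNull p T) (hI : Indistinguishable p T s t)
    {θ₀ θ₁ : Θ} (h₀ : θ₀ ∈ Θ₀) (h₁ : θ₁ ∈ Θ₁) : ¬ h θ₀ θ₁ s < h θ₀ θ₁ t := by
  rcases hI with rfl | ⟨c, q, hq⟩
  · exact lt_irrefl _
  rw [uIcc_of_le hst] at hq
  refine (Eq.not_lt ?_)
  by_cases hc : c θ₀ = 0 ∧ c θ₁ = 0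
  · refine hh.const θ₀ h₀ θ₁ h₁ (Icc s t) ordConnected_Icc hsub (fun ω hω => ?_) s
      (left_mem_Icc.2 hst) t (right_mem_Icc.2 hst)
    rw [hq ω hω, hq ω hω, hc.1, hc.2]
    simp
  · have key : ∀ x ∈ Icc s t, x ∉ totallyNull p T →
        h θ₀ θ₁ x = (c θ₀ : ℝ≥0∞) / (c θ₁ : ℝ≥0∞) := by
      intro x hx hxN
      obtain ⟨ω, rfl, θ, hθ⟩ := exists_ne_zero_of_notMem_totallyNull hxN
      have e := hq ω hx
      rw [e] at hθ
      have hq0 : q ω ≠ 0 := right_ne_zero_of_mul hθ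
      rw [← hh.ratio θ₀ h₀ θ₁ h₁ ω fun hz => hc ?_, e, e, ENNReal.coe_mul, ENNReal.coe_mul,
        ENNReal.mul_div_mul_right _ _ (by simpa using hq0) ENNReal.coe_ne_top]
      simpa [e, hq0] using hz
    rw [key s (left_mem_Icc.2 hst) hsN, key t (right_mem_Icc.2 hst) htN]

/-- Monotone ratios that do not grow from `s` to `t` are constant between them. Cross-multiplying
with a point `ω₀` above `t` makes all densities multiples of one `p θ₀`. -/
theorem indistinguishable_of_eq (hh : IsNormalizedFamily p T Θ₀ Θ₁ h) (hun : Θ₁ ∪ Θ₀ = univ)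
    (hst : s ≤ t) (hi : t ∉ lowerNull p T Θ₀) (hs : t ∉ upperNull p T Θ₁)
    (hN : t ∉ totallyNull p T) (heq : ∀ θ₀ ∈ Θ₀, ∀ θ₁ ∈ Θ₁, h θ₀ θ₁ t ≤ h θ₀ θ₁ s) :
    Indistinguishable p T s t := by
  obtain ⟨ω₀, rfl, θ₀, h₀, θ₁, h₁, hp0, hp1⟩ := hh.exists_ne_zero_and_ne_zero hun hi hs hN
  have key : ∀ ω, T ω ∈ uIcc s (T ω₀) → ∀ η₀ ∈ Θ₀, ∀ η₁ ∈ Θ₁, ¬ (p η₀ ω₀ = 0 ∧ p η₁ ω₀ = 0) →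
      p η₀ ω * p η₁ ω₀ = p η₀ ω₀ * p η₁ ω := by
    intro ω hω η₀ m₀ η₁ m₁ hne
    rw [uIcc_of_le hst] at hω
    by_cases hz : p η₀ ω = 0 ∧ p η₁ ω = 0
    · simp [hz.1, hz.2]
    · refine mul_eq_mul_of_ennreal_div_eq_div hz hne ?_
      rw [hh.ratio η₀ m₀ η₁ m₁ ω hz, hh.ratio η₀ m₀ η₁ m₁ ω₀ hne]
      exact le_antisymm (hh.mono η₀ m₀ η₁ m₁ hω.2)
        ((heq η₀ m₀ η₁ m₁).trans (hh.mono η₀ m₀ η₁ m₁ hω.1))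
  refine Or.inr ⟨fun θ => p θ ω₀ / p θ₀ ω₀, p θ₀, fun ω hω θ => ?_⟩
  rw [div_mul_eq_mul_div, eq_div_iff hp0]
  rcases hun.ge (mem_univ θ) with hm | hm
  · have := key ω hω θ₀ h₀ θ hm fun hz => hp0 hz.1
    rw [mul_comm, ← this, mul_comm]
  -- Two parameters of `Θ₀` have no ratio in the family; they are compared through `θ₁`, which is
  -- positive at `ω₀`.
  · have e1 := key ω hω θ hm θ₁ h₁ fun hz => hp1 hz.2
    have e2 := key ω hω θ₀ h₀ θ₁ h₁ fun hz => hp0 hz.1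
    refine mul_right_cancel₀ hp1 ?_
    calc p θ ω * p θ₀ ω₀ * p θ₁ ω₀ = p θ ω * p θ₁ ω₀ * p θ₀ ω₀ := by ring
      _ = p θ ω₀ * (p θ₀ ω₀ * p θ₁ ω) := by rw [e1]; ring
      _ = p θ ω₀ * p θ₀ ω * p θ₁ ω₀ := by rw [← e2]; ring

/-- One endpoint may lie in a null half-line, as `T ω` may: normalization then separates it from the
good endpoint, and so does the vanishing pattern of the densities. -/
theorem essentialFun_lt_iff_not_indistinguishable (hh : IsNormalizedFamily p T Θ₀ Θ₁ h)
    (hun : Θ₁ ∪ Θ₀ = univ) (hst : s < t) (hsN : s ∉ totallyNull p T) (htN : t ∉ totallyNull p T)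
    (hgood : s ∉ lowerNull p T Θ₀ ∪ upperNull p T Θ₁ ∨ t ∉ lowerNull p T Θ₀ ∪ upperNull p T Θ₁) :
    essentialFun Θ₀ Θ₁ h s < essentialFun Θ₀ Θ₁ h t ↔ ¬ Indistinguishable p T s t := by
  have hlow : ∀ {x y : ℝ}, x ≤ y → x ∉ lowerNull p T Θ₀ → y ∉ lowerNull p T Θ₀ :=
    fun hxy hx hy => hx fun ω hω => hy ω (hω.trans hxy)
  have hupp : ∀ {x y : ℝ}, x ≤ y → y ∉ upperNull p T Θ₁ → x ∉ upperNull p T Θ₁ :=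
    fun hxy hy hx => hy fun ω hω => hx ω (hxy.trans hω)
  simp only [mem_union, not_or] at hgood
  have hsu : s ∉ upperNull p T Θ₁ := hgood.elim And.right fun hg => hupp hst.le hg.2
  have htl : t ∉ lowerNull p T Θ₀ := hgood.elim (fun hg => hlow hst.le hg.1) And.left
  rw [essentialFun_lt_iff hh.mono]
  by_cases hsl : s ∈ lowerNull p T Θ₀
  · refine iff_of_true ?_ (not_indistinguishable_of_mem_lowerNull hst hsl hsN htl)
    obtain ⟨θ₀, h₀, hne⟩ := hh.exists_ne_zero htl
    obtain ⟨θ₁, h₁, -⟩ := hh.exists_ne_top hsu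
    refine ⟨θ₀, h₀, θ₁, h₁, ?_⟩
    rw [hh.zero θ₀ h₀ θ₁ h₁ s ⟨hsl, hsu⟩]
    exact pos_iff_ne_zero.2 (hne θ₁ h₁)
  by_cases htu : t ∈ upperNull p T Θ₁
  · refine iff_of_true ?_ (not_indistinguishable_of_mem_upperNull hst htu htN hsu)
    obtain ⟨θ₀, h₀, -⟩ := hh.exists_ne_zero htl
    obtain ⟨θ₁, h₁, hne⟩ := hh.exists_ne_top hsu
    refine ⟨θ₀, h₀, θ₁, h₁, ?_⟩
    rw [hh.top θ₀ h₀ θ₁ h₁ t htu]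
    exact lt_top_iff_ne_top.2 (hne θ₀ h₀)
  constructor
  · rintro ⟨θ₀, h₀, θ₁, h₁, hlt⟩ hI
    refine hh.not_lt_of_indistinguishable (fun x hx => ?_) hst.le hsN htN hI h₀ h₁ hlt
    exact not_or.2 ⟨hlow hx.1 hsl, hupp hx.2 htu⟩
  · intro hI
    by_contra! hno
    exact hI (hh.indistinguishable_of_eq hun hst.le htl htu htN hno)

theorem not_essentialFun_lt (hh : IsNormalizedFamily p T Θ₀ Θ₁ h) (hst : s ≤ t) :
    ¬ essentialFun Θ₀ Θ₁ h t < essentialFun Θ₀ Θ₁ h s := by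
  rw [essentialFun_lt_iff hh.mono]
  rintro ⟨θ₀, h₀, θ₁, h₁, hlt⟩
  exact hlt.not_ge (hh.mono θ₀ h₀ θ₁ h₁ hst)

end IsNormalizedFamily

/-! ### Almost sure comparison of statistics -/

theorem midCDF_congr [MeasurableSpace Ω] {P : Measure Ω} {S S' : Ω → EReal} {k k' : EReal}
    (hs : ∀ᵐ ω ∂P, (S ω < k ↔ S' ω < k') ∧ (k < S ω ↔ k' < S' ω)) :
    midCDF P S k = midCDF P S' k' := by
  unfold midCDF
  congr 2
  · exact measureReal_congr (Filter.eventuallyEq_set.2 (hs.mono fun ω hω => hω.1))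
  · refine measureReal_congr (Filter.eventuallyEq_set.2 (hs.mono fun ω hω => ?_))
    exact not_lt.symm.trans ((not_congr hω.2).trans not_lt)

theorem ae_law_ne_zero [MeasurableSpace Ω] (μ : Measure Ω) {θ : Θ} (hp : Measurable (p θ)) :
    ∀ᵐ ω ∂law μ p θ, p θ ω ≠ 0 := by
  rw [law, ae_withDensity_iff hp.coe_nnreal_ennreal]
  exact Filter.Eventually.of_forall fun ω hω => by simpa using hω

end Model

end ExpertVote

theorem proposition5p2p2 {Ω Θ : Type*} [MeasurableSpace Ω] [LinearOrder Θ]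
    (μ : Measure Ω) (p : Θ → Ω → ℝ≥0) (T : Ω → ℝ)
    (hp : ∀ θ, Measurable (p θ)) (hprob : ∀ θ, IsProbabilityMeasure (law μ p θ))
    (hT : Measurable T) (hmlr : HasMonotoneLikelihoodRatio p T) :
    ∃ K : ℝ → EReal, Monotone K ∧
      ∀ Θ₁ Θ₀ : Set Θ, IsUnilateral Θ₁ Θ₀ →
        (∃ h : Θ → Θ → ℝ → ℝ≥0∞, IsNormalizedFamily p T Θ₀ Θ₁ h) ∧
        (∀ h : Θ → Θ → ℝ → ℝ≥0∞, IsNormalizedFamily p T Θ₀ Θ₁ h →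
          ∀ t : ℝ, t ∉ lowerNull p T Θ₀ ∪ upperNull p T Θ₁ ∪ totallyNull p T → ∀ θ : Θ,
            midCDF (law μ p θ) (fun ω => K (T ω)) (K t) =
              midCDF (law μ p θ) (fun ω => essentialFun Θ₀ Θ₁ h (T ω))
                (essentialFun Θ₀ Θ₁ h t)) ∧
        (∀ t ∈ lowerNull p T Θ₀ \ totallyNull p T, ∀ θ₀ ∈ Θ₀,
          midCDF (law μ p θ₀) (fun ω => K (T ω)) (K t) = 0) ∧
        (∀ t ∈ upperNull p T Θ₁ \ totallyNull p T, ∀ θ₁ ∈ Θ₁,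
          midCDF (law μ p θ₁) (fun ω => K (T ω)) (K t) = 1) ∧
        (∀ h : Θ → Θ → ℝ → ℝ≥0∞, IsNormalizedFamily p T Θ₀ Θ₁ h →
          ∀ ω : Ω, T ω ∉ lowerNull p T Θ₀ ∪ upperNull p T Θ₁ ∪ totallyNull p T → ∀ θ : Θ,
            IsVote (law μ p θ) T (experts Θ₀ Θ₁ h) (T ω)
              (1 - midCDF (law μ p θ) (fun ω' => K (T ω')) (K (T ω)))) := by
  obtain ⟨K, hKmono, hK⟩ := exists_monotone_lt_iff_not (S := (totallyNull p T)ᶜ)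
    (r := Indistinguishable p T) (fun s => Or.inl rfl) Indistinguishable.symm
    Indistinguishable.trans Indistinguishable.of_le_of_le
  refine ⟨K, hKmono, fun Θ₁ Θ₀ hU => ?_⟩
  have hnotN : ∀ {θ ω}, p θ ω ≠ 0 → T ω ∉ totallyNull p T := fun hne hN => hne (hN _ rfl _)
  have hmid : ∀ h : Θ → Θ → ℝ → ℝ≥0∞, IsNormalizedFamily p T Θ₀ Θ₁ h →
      ∀ t : ℝ, t ∉ lowerNull p T Θ₀ ∪ upperNull p T Θ₁ ∪ totallyNull p T → ∀ θ : Θ,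
        midCDF (law μ p θ) (fun ω => K (T ω)) (K t) =
          midCDF (law μ p θ) (fun ω => essentialFun Θ₀ Θ₁ h (T ω)) (essentialFun Θ₀ Θ₁ h t) := by
    intro h hh t ht θ
    rw [mem_union, not_or] at ht
    refine midCDF_congr ((ae_law_ne_zero μ (hp θ)).mono fun ω hω => ?_)
    have hN := hnotN hω
    rcases lt_trichotomy (T ω) t with hlt | heq | hlt
    -- Almost surely `T ω` is outside `N`, but it may be in `D_i ∪ D_s`; only `t` is known to be
    -- good.
    · exact ⟨(hK _ hN _ ht.2 hlt).trans (hh.essentialFun_lt_iff_not_indistinguishable hU.union hlt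
        hN ht.2 (Or.inr ht.1)).symm,
        iff_of_false (hKmono hlt.le).not_gt (hh.not_essentialFun_lt hlt.le)⟩
    · simp [heq]
    · exact ⟨iff_of_false (hKmono hlt.le).not_gt (hh.not_essentialFun_lt hlt.le),
        (hK _ ht.2 _ hN hlt).trans (hh.essentialFun_lt_iff_not_indistinguishable hU.union hlt
        ht.2 hN (Or.inl ht.1)).symm⟩
  refine ⟨?_, hmid, ?_, ?_, ?_⟩
  · exact exists_isNormalizedFamily fun θ₀ h₀ θ₁ h₁ => hmlr θ₁ θ₀ (hU.lt θ₁ h₁ θ₀ h₀)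
  · rintro t ⟨ht, htN⟩ θ₀ h₀
    have hae : ∀ᵐ ω ∂law μ p θ₀, K t < K (T ω) := (ae_law_ne_zero μ (hp θ₀)).mono fun ω hω => by
      have hl : T ω ∉ lowerNull p T Θ₀ := fun hl => hω (hl ω le_rfl θ₀ h₀)
      have hlt : t < T ω := lt_of_not_ge fun hle => hω (ht ω hle θ₀ h₀)
      exact (hK _ htN _ (hnotN hω) hlt).2 (not_indistinguishable_of_mem_lowerNull hlt ht htN hl)
    -- Almost surely `K(T)` exceeds `K t`, so the comparison is that of the constant `+∞` with the
    -- level `-∞`.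
    rw [midCDF_congr (S' := fun _ => ⊤) (k' := ⊥) (hae.mono fun ω hω => by simp [hω, hω.not_gt])]
    simp [midCDF]
  · rintro t ⟨ht, htN⟩ θ₁ h₁
    have hae : ∀ᵐ ω ∂law μ p θ₁, K (T ω) < K t := (ae_law_ne_zero μ (hp θ₁)).mono fun ω hω => by
      have hl : T ω ∉ upperNull p T Θ₁ := fun hl => hω (hl ω le_rfl θ₁ h₁)
      have hlt : T ω < t := lt_of_not_ge fun hle => hω (ht ω hle θ₁ h₁)
      exact (hK _ (hnotN hω) _ htN hlt).2 (not_indistinguishable_of_mem_upperNull hlt ht htN hl)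
    have := hprob θ₁
    rw [midCDF_congr (S' := fun _ => ⊥) (k' := ⊤) (hae.mono fun ω hω => by simp [hω, hω.not_gt])]
    simp [midCDF]
  · intro h hh ω hω θ
    have := hprob θ
    rw [hmid h hh _ hω θ]
    simp only [mem_union, not_or] at hω
    obtain ⟨θ₀, h₀, hne₀⟩ := hh.exists_ne_zero hω.1.1
    obtain ⟨θ₁, h₁, hne₁⟩ := hh.exists_ne_top hω.1.2
    exact isVote_essentialValue hT isClosed_closure
      (lowerExpert_experts_mem hh.mono h₀ h₁ (hne₀ θ₁ h₁))
      (upperExpert_experts_mem hh.mono h₀ h₁ (hne₁ θ₀ h₀))
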